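/- Let $(\mathcal T_t)_{t\ge 0}$ be a symmetric (sub-)Markov semigroup on the real space $L^2(\mathbb R^N)$ (Lebesgue measure), i.e. a strongly continuous semigroup of bounded symmetric contractions such that $0\le f\le 1$ a.e. implies $0\le \mathcal T_tf\le 1$ a.e. Let $\mathcal Q$ be its Dirichlet form, $\mathcal Q(f,f)=\lim_{t\to0^+}t^{-1}\langle f-\mathcal T_tf,f\rangle$, whose domain $\mathfrak D$ is the set of $f\in L^2(\mathbb R^N)$ for which this limit exists and is finite; thus $\mathcal Q(f,f)=\langle Af,f\rangle$ for $f$ in the domain of the positive self-adjoint operator $A$ with $\mathcal T_t=e^{-tA}$. For $v\in L^1(\mathbb R^N)$, $\mathcal T_tv$ denotes the value at $v$ of the continuous extension to $L^1(\mathbb R^N)$ of $\mathcal T_t|_{L^1\cap L^2}$. Assume that there are constants $1\le r<2$, $d>0$ and $C_1>0$ such that every $f\in\mathfrak D\cap L^1(\mathbb R^N)$ with $\|f\|_r=1$ satisfies $$\mathcal Q(f,f)\ \ge\ C_1\,\|f\|_2^2\,\min\{1,\|f\|_2^{2/d}\}.$$ Then for all $1\le q<p<\infty$ there is a constant $C_2>0$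 such that for every $v\in L^1(\mathbb R^N)\cap L^p(\mathbb R^N)$ there is a time $t_0>0$ (which may depend on $v$) with $$\|\mathcal T_tv\|_p\ \le\ C_2\,t^{-\varrho(q,p)}\,\|v\|_q\qquad\text{for all } t>t_0,\qquad \varrho(q,p)=\frac{dr}{2-r}\Big(\frac1q-\frac1p\Big).$$ -/

import Mathlib

open MeasureTheory Filter Topology
open scoped ENNReal NNReal InnerProductSpace

noncomputable section

/-- A symmetric (sub-)Markov semigroup on `L²(α, μ)`: a strongly continuous semigroup
`(T_t)_{t ≥ 0}` of bounded symmetric contractions on the real space `L²(α, μ)` such that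
`0 ≤ f ≤ 1` implies `0 ≤ T_t f ≤ 1`. These are exactly the semigroups `T_t = e^{-tA}` of
positive self-adjoint operators `A` on `L²` whose quadratic form is a Dirichlet form. -/
structure SymmMarkovSemigroup {α : Type*} [MeasurableSpace α] (μ : Measure α) where
  /-- the operators `T_t` on `L²` -/
  op : ℝ≥0 → Lp ℝ 2 μ →L[ℝ] Lp ℝ 2 μ
  op_zero : op 0 = ContinuousLinearMap.id ℝ (Lp ℝ 2 μ)
  op_add : ∀ s t, op (s + t) = (op s).comp (op t)
  continuous_op : ∀ f, Continuous fun t => op t f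
  norm_op_le : ∀ t f, ‖op t f‖ ≤ ‖f‖
  symm : ∀ t f g, ⟪op t f, g⟫_ℝ = ⟪f, op t g⟫_ℝ
  markov : ∀ t (f : Lp ℝ 2 μ), (∀ᵐ x ∂μ, 0 ≤ f x ∧ f x ≤ 1) →
    ∀ᵐ x ∂μ, 0 ≤ op t f x ∧ op t f x ≤ 1

namespace SymmMarkovSemigroup

variable {α : Type*} [MeasurableSpace α] {μ : Measure α} (T : SymmMarkovSemigroup μ)

/-- The approximating form `Q_t(f, g) = t⁻¹ ⟨f - T_t f, g⟩`. -/
def approxForm (t : ℝ≥0) (f g : Lp ℝ 2 μ) : ℝ := (t : ℝ)⁻¹ * ⟪f - T.op t f, g⟫_ℝ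

/-- The domain of the Dirichlet form of the semigroup: all `f ∈ L²` for which
`t⁻¹ ⟨f - T_t f, f⟩` has a finite limit as `t → 0⁺`. -/
def formDomain : Set (Lp ℝ 2 μ) :=
  {f | ∃ l : ℝ, Tendsto (fun t : ℝ≥0 => T.approxForm t f f) (𝓝[>] 0) (𝓝 l)}

/-- The Dirichlet form of the semigroup, `Q(f, g) = lim_{t → 0⁺} t⁻¹ ⟨f - T_t f, g⟩`
(for `f, g` in the domain of the form). -/
def form (f g : Lp ℝ 2 μ) : ℝ :=
  limUnder (𝓝[>] (0 : ℝ≥0)) fun t => T.approxForm t f g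

/-- If `-A` is the generator of the semigroup and `f` lies in the domain of `A`,
then `Q(f, g) = ⟨A f, g⟩` for every `g ∈ L²`. -/
theorem form_eq_of_generator {f Af : Lp ℝ 2 μ}
    (h : Tendsto (fun t : ℝ≥0 => (t : ℝ)⁻¹ • (f - T.op t f)) (𝓝[>] 0) (𝓝 Af))
    (g : Lp ℝ 2 μ) : T.form f g = ⟪Af, g⟫_ℝ := by
  apply Tendsto.limUnder_eq
  have h2 := h.inner (𝕜 := ℝ) (tendsto_const_nhds (x := g))
  simpa only [approxForm, real_inner_smul_left] using h2

theorem abs_op_indicator_sub_le (t : ℝ≥0) {A B : Set α} (hA : MeasurableSet A)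
    (hB : MeasurableSet B) (hμA : μ A ≠ ∞) (hμB : μ B ≠ ∞) :
    ∀ᵐ x ∂μ, |op T t (indicatorConstLp 2 hA hμA 1) x
      - op T t (indicatorConstLp 2 hB hμB 1) x| ≤ 1 := by
  have key : ∀ {S : Set α} (hS : MeasurableSet S) (hμS : μ S ≠ ∞),
      ∀ᵐ x ∂μ, 0 ≤ op T t (indicatorConstLp 2 hS hμS 1) x ∧
        op T t (indicatorConstLp 2 hS hμS 1) x ≤ 1 := by
    intro S hS hμS
    apply T.markov
    filter_upwards [indicatorConstLp_coeFn (p := 2) (hs := hS) (hμs := hμS) (c := (1 : ℝ))]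
      with x hx
    rw [hx]
    by_cases h : x ∈ S <;> simp [h]
  filter_upwards [key hA hμA, key hB hμB] with x h1 h2
  rw [abs_le]
  constructor <;> linarith [h1.1, h1.2, h2.1, h2.2]

/-- Each `T_t` contracts the `L¹` norm on `L¹ ∩ L²`. -/
theorem eLpNorm_one_op_le (t : ℝ≥0) (f : Lp ℝ 2 μ) (hf : MemLp f 1 μ) :
    eLpNorm (T.op t f) 1 μ ≤ eLpNorm f 1 μ := by
  set g : Lp ℝ 2 μ := T.op t f with hg
  have hgm : Measurable g := (Lp.stronglyMeasurable g).measurable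
  have hfi : Integrable f μ := memLp_one_iff_integrable.1 hf
  have hlev : ∀ ε : ℝ, 0 < ε → μ {x | ε ≤ |g x|} ≠ ∞ := by
    intro ε hε
    have := (Lp.memLp g).meas_ge_lt_top' (by norm_num) (by norm_num)
      (ε := ENNReal.ofReal ε) (by simpa using hε)
    refine ne_of_lt (lt_of_le_of_lt (measure_mono ?_) this)
    intro x hx
    change ENNReal.ofReal ε ≤ ‖g x‖ₑ
    rw [← ofReal_norm]
    exact ENNReal.ofReal_le_ofReal hx
  have hstep : ∀ ε : ℝ, 0 < ε → ∫⁻ x in {x | ε ≤ |g x|}, ‖g x‖ₑ ∂μ ≤ eLpNorm f 1 μ := by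
    intro ε hε
    have hA : MeasurableSet {x | ε ≤ g x} := measurableSet_le measurable_const hgm
    have hB : MeasurableSet {x | g x ≤ -ε} := measurableSet_le hgm measurable_const
    have hμA : μ {x | ε ≤ g x} ≠ ∞ := ne_top_of_le_ne_top (hlev ε hε)
      (measure_mono fun x hx => le_trans (show ε ≤ g x from hx) (le_abs_self (g x)))
    have hμB : μ {x | g x ≤ -ε} ≠ ∞ := ne_top_of_le_ne_top (hlev ε hε)
      (measure_mono fun x hx => by
        have hx' : g x ≤ -ε := hx
        exact le_trans (by linarith) (neg_le_abs (g x)))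
    have hE : MeasurableSet {x | ε ≤ |g x|} := measurableSet_le measurable_const hgm.abs
    have hgA : IntegrableOn g {x | ε ≤ g x} μ :=
      integrableOn_Lp_of_measure_ne_top g fact_one_le_two_ennreal.elim hμA
    have hgB : IntegrableOn g {x | g x ≤ -ε} μ :=
      integrableOn_Lp_of_measure_ne_top g fact_one_le_two_ennreal.elim hμB
    have hgE : IntegrableOn g {x | ε ≤ |g x|} μ :=
      integrableOn_Lp_of_measure_ne_top g fact_one_le_two_ennreal.elim (hlev ε hε)
    have e1 : ∫ x in {x | ε ≤ |g x|}, |g x| ∂μ =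
        ⟪indicatorConstLp 2 hA hμA (1 : ℝ) - indicatorConstLp 2 hB hμB (1 : ℝ), g⟫_ℝ := by
      rw [inner_sub_left, L2.inner_indicatorConstLp_one, L2.inner_indicatorConstLp_one,
        ← integral_indicator hE, ← integral_indicator hA, ← integral_indicator hB,
        ← integral_sub (hgA.integrable_indicator hA) (hgB.integrable_indicator hB)]
      congr 1
      funext x
      simp only [Set.indicator_apply, Set.mem_ofPred_eq, le_abs']
      rcases abs_cases (g x) with ⟨h, h'⟩ | ⟨h, h'⟩ <;> rw [h] <;> split_ifs <;>
        first
          | (exfalso; tauto)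
          | (exfalso; linarith)
          | ring
    have e2 : ⟪indicatorConstLp 2 hA hμA (1 : ℝ) - indicatorConstLp 2 hB hμB (1 : ℝ), g⟫_ℝ =
        ∫ x, ⟪(T.op t (indicatorConstLp 2 hA hμA 1) - T.op t (indicatorConstLp 2 hB hμB 1) :
          Lp ℝ 2 μ) x, f x⟫_ℝ ∂μ := by
      exact (T.symm t _ f).symm.trans (by rw [map_sub, L2.inner_def])
    have e3 : ∫ x in {x | ε ≤ |g x|}, |g x| ∂μ ≤ ∫ x, |f x| ∂μ := by
      rw [e1, e2]
      refine le_trans (Real.le_norm_self _) (norm_integral_le_of_norm_le hfi.abs ?_)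
      filter_upwards [T.abs_op_indicator_sub_le t hA hB hμA hμB,
        Lp.coeFn_sub (T.op t (indicatorConstLp 2 hA hμA 1))
          (T.op t (indicatorConstLp 2 hB hμB 1))] with x h1 h2
      rw [h2, Pi.sub_apply]
      refine le_trans (norm_inner_le_norm _ _) ?_
      simp only [Real.norm_eq_abs]
      exact mul_le_of_le_one_left (abs_nonneg _) h1
    have e4 : ∫⁻ x in {x | ε ≤ |g x|}, ‖g x‖ₑ ∂μ =
        ENNReal.ofReal (∫ x in {x | ε ≤ |g x|}, |g x| ∂μ) :=
      (ofReal_integral_norm_eq_lintegral_enorm hgE).symm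
    have e5 : eLpNorm f 1 μ = ENNReal.ofReal (∫ x, |f x| ∂μ) := by
      rw [eLpNorm_one_eq_lintegral_enorm]
      exact (ofReal_integral_norm_eq_lintegral_enorm hfi).symm
    rw [e4, e5]
    exact ENNReal.ofReal_le_ofReal e3
  rw [eLpNorm_one_eq_lintegral_enorm]
  have hU : ∫⁻ x, ‖g x‖ₑ ∂μ =
      ∫⁻ x in ⋃ n : ℕ, {x | 1 / ((n : ℝ) + 1) ≤ |g x|}, ‖g x‖ₑ ∂μ := by
    symm
    apply setLIntegral_eq_of_support_subset
    intro x hx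
    have hx' : 0 < |g x| := by
      simpa [Function.mem_support] using hx
    obtain ⟨n, hn⟩ := exists_nat_one_div_lt hx'
    exact Set.mem_iUnion.2 ⟨n, hn.le⟩
  rw [hU, setLIntegral_iUnion_of_directed]
  · exact iSup_le fun n => hstep _ (by positivity)
  · apply Monotone.directed_le
    intro m n hmn x hx
    refine le_trans ?_ (show 1 / ((m : ℝ) + 1) ≤ |g x| from hx)
    gcongr

/-- The subspace `L¹ ∩ L²` of `L¹`. -/
def l1l2 (μ : Measure α) : Submodule ℝ (Lp ℝ 1 μ) where
  carrier := {f | MemLp f 2 μ}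
  zero_mem' := (memLp_congr_ae (Lp.coeFn_zero ℝ 1 μ)).2 MemLp.zero
  add_mem' := fun {f g} hf hg => (memLp_congr_ae (Lp.coeFn_add f g)).2 (MemLp.add hf hg)
  smul_mem' := fun c f hf => (memLp_congr_ae (Lp.coeFn_smul c f)).2 (MemLp.const_smul hf c)

theorem memLp_two (f : l1l2 μ) : MemLp (f : Lp ℝ 1 μ) 2 μ := f.2

/-- The inclusion of `L¹ ∩ L²` in `L²`. -/
def toL2 : l1l2 μ →ₗ[ℝ] Lp ℝ 2 μ where
  toFun f := (memLp_two f).toLp _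
  map_add' f g := by
    rw [← MemLp.toLp_add (memLp_two f) (memLp_two g)]
    exact (MemLp.toLp_eq_toLp_iff _ _).2 (Lp.coeFn_add _ _)
  map_smul' c f := by
    rw [RingHom.id_apply, ← MemLp.toLp_const_smul c (memLp_two f)]
    exact (MemLp.toLp_eq_toLp_iff _ _).2 (Lp.coeFn_smul _ _)

theorem toL2_ae_eq (f : l1l2 μ) : toL2 f =ᵐ[μ] (f : Lp ℝ 1 μ) := MemLp.coeFn_toLp (memLp_two f)

theorem memLp_one_op_toL2 (t : ℝ≥0) (f : l1l2 μ) : MemLp (T.op t (toL2 f)) 1 μ := by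
  have h : MemLp (toL2 f) 1 μ := (memLp_congr_ae (toL2_ae_eq f)).2 (Lp.memLp _)
  exact ⟨Lp.aestronglyMeasurable _, lt_of_le_of_lt (T.eLpNorm_one_op_le t _ h) h.2⟩

/-- The operator `T_t`, restricted to `L¹ ∩ L²` and regarded as a map into `L¹`. -/
def preOpL1 (t : ℝ≥0) : l1l2 μ →ₗ[ℝ] Lp ℝ 1 μ where
  toFun f := (T.memLp_one_op_toL2 t f).toLp _
  map_add' f g := by
    rw [← MemLp.toLp_add (T.memLp_one_op_toL2 t f) (T.memLp_one_op_toL2 t g),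
      MemLp.toLp_eq_toLp_iff, map_add, map_add]
    exact Lp.coeFn_add _ _
  map_smul' c f := by
    rw [RingHom.id_apply, ← MemLp.toLp_const_smul c (T.memLp_one_op_toL2 t f),
      MemLp.toLp_eq_toLp_iff, map_smul, map_smul]
    exact Lp.coeFn_smul _ _

theorem norm_preOpL1_le (t : ℝ≥0) (f : l1l2 μ) :
    ‖T.preOpL1 t f‖ ≤ 1 * ‖(l1l2 μ).subtype f‖ := by
  rw [one_mul, Submodule.subtype_apply, Lp.norm_def, Lp.norm_def]
  refine ENNReal.toReal_mono (Lp.eLpNorm_ne_top _) ?_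
  have h := toL2_ae_eq f
  refine le_of_eq_of_le (eLpNorm_congr_ae (MemLp.coeFn_toLp (T.memLp_one_op_toL2 t f))) ?_
  refine le_of_le_of_eq (T.eLpNorm_one_op_le t _ ?_) (eLpNorm_congr_ae h)
  exact (memLp_congr_ae h).2 (Lp.memLp _)

theorem denseRange_l1l2 : DenseRange (l1l2 μ).subtype := by
  have h : Dense (Lp.simpleFunc ℝ 1 μ : Set (Lp ℝ 1 μ)) := Lp.simpleFunc.dense (by norm_num)
  have hsub : (Lp.simpleFunc ℝ 1 μ : Set (Lp ℝ 1 μ)) ⊆ Set.range (l1l2 μ).subtype := by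
    intro f hf
    refine ⟨⟨f, ?_⟩, rfl⟩
    let s : Lp.simpleFunc ℝ 1 μ := ⟨f, hf⟩
    have hs : MemLp (Lp.simpleFunc.toSimpleFunc s) 1 μ := Lp.simpleFunc.memLp s
    have h2 : MemLp (Lp.simpleFunc.toSimpleFunc s) 2 μ :=
      (SimpleFunc.memLp_iff (by norm_num) (by norm_num)).2
        ((SimpleFunc.memLp_iff (by norm_num) (by norm_num)).1 hs)
    exact (memLp_congr_ae (Lp.simpleFunc.toSimpleFunc_eq_toFun s)).1 h2
  exact h.mono hsub

/-- The operator `T_t` on `L¹`: the unique continuous extension to `L¹` of the restriction of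
`T_t` to `L¹ ∩ L²`. -/
def opL1 (t : ℝ≥0) : Lp ℝ 1 μ →L[ℝ] Lp ℝ 1 μ := (T.preOpL1 t).extendOfNorm (l1l2 μ).subtype

/-- On `L¹ ∩ L²` the extension agrees with `T_t`. -/
theorem opL1_ae_eq (t : ℝ≥0) (v : Lp ℝ 1 μ) (hv : MemLp v 2 μ) :
    T.opL1 t v =ᵐ[μ] T.op t (hv.toLp v) := by
  have h : T.opL1 t v = T.preOpL1 t ⟨v, hv⟩ :=
    LinearMap.extendOfNorm_eq denseRange_l1l2 ⟨1, T.norm_preOpL1_le t⟩ ⟨v, hv⟩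
  rw [h]
  exact MemLp.coeFn_toLp (T.memLp_one_op_toL2 t ⟨v, hv⟩)

end SymmMarkovSemigroup

end

/-!
Hölder's inequality between `L¹`, `L^r` and `L²` turns the Nash inequality for `L^r` into one for
`L¹` with `d` replaced by `D = d r / (2 - r)`. For `f ∈ L¹ ∩ L²` the function `y t = ⟨T_t f, f⟩` is
convex with derivative `-Q(T_{t/2} f, T_{t/2} f)`, and `‖T_t f‖₁ ≤ ‖f‖₁`, so the Nash inequality is
a differential inequality for `y`. Integrating it gives the decay `t^{-D/2}` from `L¹` to `L²`, up
to an exponentially small multiple of `‖f‖₂`.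

The passage to other exponents has to respect this error term. It rests on the pointwise inequality
`T_t h ≤ (T_t f)^θ (T_t g)^η` for `h ≤ f^θ g^η`. Writing `v ≤ f^θ g^η` with `f` controlled in `L¹`
and `g` in `L¹ ∩ L²` yields the decay from `L¹` to `L^s` for `s ≤ 2`. The case `η = 0` is Jensen's
inequality `(T_t f)^m ≤ T_t (f^m)`, which carries decay from `(q, p)` over to `(q m, p m)`. The
semigroup law composes such steps and reaches all `1 ≤ q < p < ∞`. The error term, smaller than any
power of `t`, is absorbed once `t` is large in terms of `‖v‖_p / ‖v‖_q`.
-/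

section RealAnalysis

open Set

theorem nonpos_of_midpoint_le {g : ℝ → ℝ} (hg : ContinuousOn g (Icc 0 1)) (h₀ : g 0 ≤ 0)
    (h₁ : g 1 ≤ 0)
    (hmid : ∀ x ∈ Icc (0 : ℝ) 1, ∀ y ∈ Icc (0 : ℝ) 1, g ((x + y) / 2) ≤ (g x + g y) / 2) :
    ∀ x ∈ Icc (0 : ℝ) 1, g x ≤ 0 := by
  have zero_mem : (0 : ℝ) ∈ Icc (0 : ℝ) 1 := by simp
  have one_mem : (1 : ℝ) ∈ Icc (0 : ℝ) 1 := by simp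
  obtain ⟨m, hm, hmax⟩ := isCompact_Icc.exists_isMaxOn ⟨0, zero_mem⟩ hg
  suffices hgm : g m ≤ 0 from fun x hx => (hmax hx).trans hgm
  obtain hm' | hm' := le_total m (1 / 2)
  · have hm₂ : 2 * m ∈ Icc (0 : ℝ) 1 := ⟨by linarith [hm.1], by linarith⟩
    have := hmid 0 zero_mem (2 * m) hm₂
    rw [show (0 + 2 * m) / 2 = m by ring] at this
    linarith [isMaxOn_iff.1 hmax _ hm₂]
  · have hm₂ : 2 * m - 1 ∈ Icc (0 : ℝ) 1 := ⟨by linarith, by linarith [hm.2]⟩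
    have := hmid 1 one_mem (2 * m - 1) hm₂
    rw [show (1 + (2 * m - 1)) / 2 = m by ring] at this
    linarith [isMaxOn_iff.1 hmax _ hm₂]

theorem convexOn_of_continuousOn_of_midpoint_le {s : Set ℝ} (hs : Convex ℝ s) {f : ℝ → ℝ}
    (hf : ContinuousOn f s) (hmid : ∀ x ∈ s, ∀ y ∈ s, f ((x + y) / 2) ≤ (f x + f y) / 2) :
    ConvexOn ℝ s f := by
  refine ⟨hs, fun x hx y hy a b ha hb hab => ?_⟩
  have mem_s : ∀ c ∈ Icc (0 : ℝ) 1, (1 - c) * x + c * y ∈ s := fun c hc =>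
    hs hx hy (sub_nonneg.2 hc.2) hc.1 (by ring)
  have key := nonpos_of_midpoint_le
    (g := fun c => f ((1 - c) * x + c * y) - ((1 - c) * f x + c * f y))
    ((hf.comp (by fun_prop) mem_s).sub (by fun_prop)) (by simp) (by simp)
    (fun c hc c' hc' => by
      have := hmid _ (mem_s c hc) _ (mem_s c' hc')
      rw [show ((1 - c) * x + c * y + ((1 - c') * x + c' * y)) / 2 =
        (1 - (c + c') / 2) * x + (c + c') / 2 * y by ring] at this
      linarith)
    b ⟨hb, by linarith⟩
  rw [show 1 - b = a by linarith] at key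
  exact sub_nonpos.1 key

theorem le_exp_mul_of_deriv_right_le {y y' : ℝ → ℝ} {a b C : ℝ} (hab : a ≤ b)
    (hy : ContinuousOn y (Icc a b)) (hy' : ∀ x ∈ Ico a b, HasDerivWithinAt y (y' x) (Ici x) x)
    (hle : ∀ x ∈ Ico a b, y' x ≤ -C * y x) :
    y b ≤ Real.exp (-C * (b - a)) * y a := by
  have := le_gronwallBound_of_liminf_deriv_right_le (δ := y a) (K := -C) (ε := 0) hy
    (fun x hx _ hr => (hy' x hx).liminf_right_slope_le hr) le_rfl
    (fun x hx => by simpa using hle x hx) b (right_mem_Icc.2 hab)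
  rwa [gronwallBound_ε0, mul_comm] at this

theorem le_rpow_of_deriv_right_le {y y' : ℝ → ℝ} {a b C D : ℝ} (hC : 0 < C) (hD : 0 < D)
    (hab : a < b) (hy : ContinuousOn y (Icc a b)) (hpos : ∀ x ∈ Icc a b, 0 < y x)
    (hy' : ∀ x ∈ Ico a b, HasDerivWithinAt y (y' x) (Ici x) x)
    (hle : ∀ x ∈ Ico a b, y' x ≤ -C * (y x * y x ^ (1 / D))) :
    y b ≤ (D / (C * (b - a))) ^ D := by
  have growth : C / D * (b - a) ≤ y b ^ (-(1 / D)) := by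
    refine image_le_of_deriv_right_le_deriv_boundary (f := fun x => C / D * (x - a))
      (B := fun x => y x ^ (-(1 / D))) (f' := fun _ => C / D)
      (B' := fun x => y' x * -(1 / D) * y x ^ (-(1 / D) - 1)) (by fun_prop)
      (fun x _ => ?_) ?_ (hy.rpow_const fun x hx => Or.inl (hpos x hx).ne')
      (fun x hx => (hy' x hx).rpow_const (Or.inl (hpos x (Ico_subset_Icc_self hx)).ne'))
      (fun x hx => ?_) (right_mem_Icc.2 hab.le)
    · simpa using (((hasDerivAt_id' x).sub_const a).const_mul (C / D)).hasDerivWithinAt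
    · simpa using Real.rpow_nonneg (hpos a (left_mem_Icc.2 hab.le)).le _
    · have hyx := hpos x (Ico_subset_Icc_self hx)
      have cancel : y x * y x ^ (1 / D) * y x ^ (-(1 / D) - 1) = 1 := by
        rw [← Real.rpow_one_add' hyx.le (by positivity), ← Real.rpow_add hyx]
        ring_nf
        exact Real.rpow_zero _
      calc C / D = C * (y x * y x ^ (1 / D)) * (1 / D) * y x ^ (-(1 / D) - 1) := by
            linear_combination (-(C / D)) * cancel
        _ ≤ y' x * -(1 / D) * y x ^ (-(1 / D) - 1) := by
            rw [mul_neg, ← neg_mul]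
            gcongr
            linarith [hle x hx]
  have hyb := hpos b (right_mem_Icc.2 hab.le)
  have hba : 0 < b - a := sub_pos.2 hab
  calc y b = (y b ^ (-(1 / D))) ^ (-D) := by
        rw [← Real.rpow_mul hyb.le, neg_mul_neg, one_div_mul_cancel hD.ne', Real.rpow_one]
    _ ≤ (C / D * (b - a)) ^ (-D) :=
        Real.rpow_le_rpow_of_nonpos (by positivity) growth (by linarith)
    _ = (D / (C * (b - a))) ^ D := by
        rw [Real.rpow_neg (by positivity), ← Real.inv_rpow (by positivity)]
        congr 1
        field_simp

theorem le_exp_mul_of_deriv_right_le_min {y y' : ℝ → ℝ} {a b C D L : ℝ} (hD : 0 ≤ D)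
    (hL : 0 < L) (hab : a ≤ b) (hLb : L ≤ y b) (hy : ContinuousOn y (Icc a b))
    (hanti : AntitoneOn y (Icc a b)) (hy' : ∀ x ∈ Ico a b, HasDerivWithinAt y (y' x) (Ici x) x)
    (hle : ∀ x ∈ Ico a b, y' x ≤ -C * (y x * min 1 ((y x / L) ^ (1 / D)))) :
    y b ≤ Real.exp (-C * (b - a)) * y a := by
  refine le_exp_mul_of_deriv_right_le hab hy hy' fun x hx => ?_
  have one_le_ratio : 1 ≤ y x / L := (one_le_div hL).2 <|
    hLb.trans (hanti (Ico_subset_Icc_self hx) (right_mem_Icc.2 hab) hx.2.le)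
  have := hle x hx
  rwa [min_eq_left (Real.one_le_rpow one_le_ratio (by positivity)), mul_one] at this

theorem le_rpow_mul_of_deriv_right_le_min {y y' : ℝ → ℝ} {a b C D L : ℝ} (hC : 0 < C)
    (hD : 0 < D) (hL : 0 < L) (hab : a < b) (haL : y a ≤ L) (hy : ContinuousOn y (Icc a b))
    (hanti : AntitoneOn y (Icc a b)) (hy' : ∀ x ∈ Ico a b, HasDerivWithinAt y (y' x) (Ici x) x)
    (hle : ∀ x ∈ Ico a b, y' x ≤ -C * (y x * min 1 ((y x / L) ^ (1 / D)))) :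
    y b ≤ (D / (C * (b - a))) ^ D * L := by
  have : 0 < b - a := sub_pos.2 hab
  obtain hyb | hyb := le_or_gt (y b) 0
  · exact hyb.trans (by positivity)
  have pos (x : ℝ) (hx : x ∈ Icc a b) : 0 < y x :=
    hyb.trans_le (hanti hx (right_mem_Icc.2 hab.le) hx.2)
  rw [← div_le_iff₀ hL]
  refine le_rpow_of_deriv_right_le (y := fun x => y x / L) (y' := fun x => y' x / L) hC hD hab
    (hy.div_const L) (fun x hx => div_pos (pos x hx) hL) (fun x hx => (hy' x hx).div_const L)
    fun x hx => ?_
  have hyx := pos x (Ico_subset_Icc_self hx)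
  have ratio_le : y x / L ≤ 1 := (div_le_one hL).2 <|
    (hanti (left_mem_Icc.2 hab.le) (Ico_subset_Icc_self hx) hx.1).trans haL
  have := hle x hx
  rw [min_eq_right (Real.rpow_le_one (by positivity) ratio_le (by positivity))] at this
  rw [div_le_iff₀ hL]
  exact this.trans_eq (by field_simp)

theorem le_add_of_deriv_right_le_min {y y' : ℝ → ℝ} {t C D L : ℝ} (hC : 0 < C) (hD : 0 < D)
    (hL : 0 < L) (ht : 0 < t) (hy : ContinuousOn y (Icc 0 t)) (hanti : AntitoneOn y (Icc 0 t))
    (h₀ : 0 ≤ y 0) (hy' : ∀ x ∈ Ioo 0 t, HasDerivWithinAt y (y' x) (Ici x) x)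
    (hle : ∀ x ∈ Ioo 0 t, y' x ≤ -C * (y x * min 1 ((y x / L) ^ (1 / D)))) :
    y t ≤ (3 * D / (C * t)) ^ D * L + Real.exp (-C * (t / 3)) * y 0 := by
  -- Once `y` is below `L` at time `2 * t / 3`, the power law holds on the last third of `[0, t]`;
  -- otherwise `y` decays exponentially on the middle third.
  obtain small | large := le_or_gt (y (2 * t / 3)) L
  · have sub_Icc : Icc (2 * t / 3) t ⊆ Icc 0 t := Icc_subset_Icc_left (by positivity)
    have sub_Ioo : Ico (2 * t / 3) t ⊆ Ioo 0 t := fun x hx => ⟨by linarith [hx.1], hx.2⟩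
    refine le_add_of_le_of_nonneg ?_ (by positivity)
    rw [show 3 * D / (C * t) = D / (C * (t - 2 * t / 3)) by field_simp; ring]
    exact le_rpow_mul_of_deriv_right_le_min hC hD hL (by linarith) small (hy.mono sub_Icc)
      (hanti.mono sub_Icc) (fun x hx => hy' x (sub_Ioo hx)) fun x hx => hle x (sub_Ioo hx)
  · have sub_Icc : Icc (t / 3) (2 * t / 3) ⊆ Icc 0 t :=
      Icc_subset_Icc (by positivity) (by linarith)
    have sub_Ioo : Ico (t / 3) (2 * t / 3) ⊆ Ioo 0 t := fun x hx =>
      ⟨by linarith [hx.1], by linarith [hx.2]⟩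
    refine le_add_of_nonneg_of_le (by positivity) ?_
    calc y t ≤ y (2 * t / 3) :=
          hanti ⟨by positivity, by linarith⟩ (right_mem_Icc.2 ht.le) (by linarith)
      _ ≤ Real.exp (-C * (2 * t / 3 - t / 3)) * y (t / 3) :=
          le_exp_mul_of_deriv_right_le_min hD.le hL (by linarith) large.le (hy.mono sub_Icc)
            (hanti.mono sub_Icc) (fun x hx => hy' x (sub_Ioo hx)) fun x hx => hle x (sub_Ioo hx)
      _ ≤ Real.exp (-C * (t / 3)) * y 0 := by
          rw [show 2 * t / 3 - t / 3 = t / 3 by ring]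
          gcongr
          exact hanti (left_mem_Icc.2 ht.le) ⟨by positivity, by linarith⟩ (by positivity)

end RealAnalysis

section LpNorms

variable {α E F G : Type*} [MeasurableSpace α] {μ : Measure α} [NormedAddCommGroup E]
  [NormedAddCommGroup F] [NormedAddCommGroup G] {f : α → E} {g : α → F} {h : α → G}

theorem eLpNorm_ofReal_eq_eLpNorm' {p : ℝ} (hp : 0 < p) :
    eLpNorm f (ENNReal.ofReal p) μ = eLpNorm' f p μ := by
  rw [eLpNorm_eq_eLpNorm' (by simpa using hp) ENNReal.ofReal_ne_top, ENNReal.toReal_ofReal hp.le]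

theorem eLpNorm_le_rpow_mul_rpow {p q s θ η : ℝ} (hp : 0 < p) (hq : 0 < q) (hs : 0 < s)
    (hθ : 0 ≤ θ) (hη : 0 ≤ η) (hpqs : θ / p + η / q = 1 / s) (hf : AEStronglyMeasurable f μ)
    (hg : AEStronglyMeasurable g μ) (hle : ∀ᵐ x ∂μ, ‖h x‖ₑ ≤ ‖f x‖ₑ ^ θ * ‖g x‖ₑ ^ η) :
    eLpNorm h (ENNReal.ofReal s) μ ≤
      eLpNorm f (ENNReal.ofReal p) μ ^ θ * eLpNorm g (ENNReal.ofReal q) μ ^ η := by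
  have hθ' : 0 ≤ θ * s / p := by positivity
  have hη' : 0 ≤ η * s / q := by positivity
  have weights_sum : θ * s / p + η * s / q = 1 := by
    rw [mul_div_right_comm, mul_div_right_comm, ← add_mul, hpqs, one_div_mul_cancel hs.ne']
  simp only [eLpNorm_ofReal_eq_eLpNorm', hp, hq, hs, eLpNorm'_eq_lintegral_enorm]
  calc (∫⁻ x, ‖h x‖ₑ ^ s ∂μ) ^ (1 / s)
      ≤ (∫⁻ x, (‖f x‖ₑ ^ p) ^ (θ * s / p) * (‖g x‖ₑ ^ q) ^ (η * s / q) ∂μ) ^ (1 / s) := by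
        gcongr ?_ ^ _
        refine lintegral_mono_ae (hle.mono fun x hx => ?_)
        rw [← ENNReal.rpow_mul, ← ENNReal.rpow_mul, mul_div_cancel₀ _ hp.ne',
          mul_div_cancel₀ _ hq.ne', ENNReal.rpow_mul, ENNReal.rpow_mul,
          ← ENNReal.mul_rpow_of_nonneg _ _ hs.le]
        gcongr
    _ ≤ ((∫⁻ x, ‖f x‖ₑ ^ p ∂μ) ^ (θ * s / p) * (∫⁻ x, ‖g x‖ₑ ^ q ∂μ) ^ (η * s / q)) ^ (1 / s) := by
        gcongr
        exact ENNReal.lintegral_mul_norm_pow_le (hf.enorm.pow_const p) (hg.enorm.pow_const q)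
          hθ' hη' weights_sum
    _ = _ := by
        rw [ENNReal.mul_rpow_of_nonneg _ _ (by positivity)]
        simp only [← ENNReal.rpow_mul]
        congr 2 <;> field_simp

theorem eLpNorm_le_max {p s q : ℝ} (hp : 0 < p) (hps : p ≤ s) (hsq : s ≤ q)
    (hf : AEStronglyMeasurable f μ) :
    eLpNorm f (ENNReal.ofReal s) μ ≤
      max (eLpNorm f (ENNReal.ofReal p) μ) (eLpNorm f (ENNReal.ofReal q) μ) := by
  obtain rfl | hps := hps.eq_or_lt
  · exact le_max_left _ _
  have hs : 0 < s := hp.trans hps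
  have hq : 0 < q := hs.trans_le hsq
  have inv_lt : 1 / q < 1 / p := one_div_lt_one_div_of_lt hp (hps.trans_le hsq)
  obtain ⟨η, θ, hη, hθ, hsum, hcomb⟩ : 1 / s ∈ segment ℝ (1 / q) (1 / p) := by
    rw [segment_eq_Icc inv_lt.le]
    exact ⟨one_div_le_one_div_of_le hs hsq, one_div_le_one_div_of_le hp hps.le⟩
  refine (eLpNorm_le_rpow_mul_rpow hp hq hs hθ hη (by rw [← hcomb]; simp; ring) hf hf
    (.of_forall fun x => ?_)).trans ?_
  · rw [← ENNReal.rpow_add_of_nonneg _ _ hθ hη, add_comm, hsum, ENNReal.rpow_one]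
  · set M := max (eLpNorm f (ENNReal.ofReal p) μ) (eLpNorm f (ENNReal.ofReal q) μ)
    calc _ ≤ M ^ θ * M ^ η := by gcongr <;> simp [M]
      _ = M := by rw [← ENNReal.rpow_add_of_nonneg _ _ hθ hη, add_comm, hsum, ENNReal.rpow_one]

theorem memLp_of_le_of_le {p s q : ℝ} (hp : 0 < p) (hps : p ≤ s) (hsq : s ≤ q)
    (hfp : MemLp f (ENNReal.ofReal p) μ) (hfq : MemLp f (ENNReal.ofReal q) μ) :
    MemLp f (ENNReal.ofReal s) μ :=
  ⟨hfp.1, (eLpNorm_le_max hp hps hsq hfp.1).trans_lt (max_lt hfp.2 hfq.2)⟩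

theorem lpNorm_le_rpow_mul_rpow {p s q θ : ℝ} (hp : 0 < p) (hps : p ≤ s) (hsq : s ≤ q)
    (hθ₀ : 0 ≤ θ) (hθ₁ : θ ≤ 1) (hpqs : θ / p + (1 - θ) / q = 1 / s)
    (hfp : MemLp f (ENNReal.ofReal p) μ) (hfq : MemLp f (ENNReal.ofReal q) μ) :
    lpNorm f (ENNReal.ofReal s) μ ≤
      lpNorm f (ENNReal.ofReal p) μ ^ θ * lpNorm f (ENNReal.ofReal q) μ ^ (1 - θ) := by
  have hs : 0 < s := hp.trans_le hps
  have := eLpNorm_le_rpow_mul_rpow (h := f) hp (hs.trans_le hsq) hs hθ₀ (sub_nonneg.2 hθ₁) hpqs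
    hfp.1 hfp.1 (.of_forall fun x => by
      rw [← ENNReal.rpow_add_of_nonneg _ _ hθ₀ (sub_nonneg.2 hθ₁), add_sub_cancel,
        ENNReal.rpow_one])
  rw [← ofReal_lpNorm hfp, ← ofReal_lpNorm hfq,
    ← ofReal_lpNorm (memLp_of_le_of_le hp hps hsq hfp hfq),
    ENNReal.ofReal_rpow_of_nonneg lpNorm_nonneg hθ₀,
    ENNReal.ofReal_rpow_of_nonneg lpNorm_nonneg (sub_nonneg.2 hθ₁),
    ← ENNReal.ofReal_mul (Real.rpow_nonneg lpNorm_nonneg _)] at this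
  refine (ENNReal.ofReal_le_ofReal_iff (mul_nonneg ?_ ?_)).1 this <;>
    exact Real.rpow_nonneg lpNorm_nonneg _

theorem norm_eq_lpNorm {p : ℝ≥0∞} (f : Lp E p μ) : ‖f‖ = lpNorm f p μ := by
  rw [Lp.norm_def, toReal_eLpNorm (Lp.aestronglyMeasurable f)]

theorem lpNorm_pos_of_ne_zero {p q : ℝ≥0∞} {f : Lp E p μ} (hf : f ≠ 0) (hq : q ≠ 0)
    (hfq : MemLp f q μ) : 0 < lpNorm f q μ :=
  lpNorm_nonneg.lt_of_ne' fun h =>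
    hf (Lp.eq_zero_iff_ae_eq_zero.2 ((lpNorm_eq_zero hfq hq).1 h))

end LpNorms

namespace SymmMarkovSemigroup

section Energy

variable {α : Type*} [MeasurableSpace α] {μ : Measure α} (T : SymmMarkovSemigroup μ)
  (f : Lp ℝ 2 μ)

theorem op_add_apply (s t : ℝ≥0) : T.op (s + t) f = T.op s (T.op t f) := by
  rw [T.op_add, ContinuousLinearMap.comp_apply]

theorem inner_op_op (s t : ℝ≥0) : ⟪T.op s f, T.op t f⟫_ℝ = ⟪T.op (s + t) f, f⟫_ℝ := by
  rw [← T.symm, ← T.op_add_apply, add_comm]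

theorem inner_op_self (t : ℝ≥0) : ⟪T.op t f, f⟫_ℝ = ‖T.op (t / 2) f‖ ^ 2 := by
  rw [← real_inner_self_eq_norm_sq, T.inner_op_op, add_halves]

theorem continuous_inner_op : Continuous fun x : ℝ => ⟪T.op x.toNNReal f, f⟫_ℝ :=
  ((T.continuous_op f).comp continuous_real_toNNReal).inner continuous_const

theorem convexOn_inner_op : ConvexOn ℝ (Set.Ici 0) fun x : ℝ => ⟪T.op x.toNNReal f, f⟫_ℝ := by
  refine convexOn_of_continuousOn_of_midpoint_le (convex_Ici 0)
    (T.continuous_inner_op f).continuousOn fun x hx y hy => ?_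
  have hx : 0 ≤ x := hx
  have hy : 0 ≤ y := hy
  have split : ((x + y) / 2).toNNReal = x.toNNReal / 2 + y.toNNReal / 2 := by
    rw [← add_div, ← Real.toNNReal_add hx hy, Real.toNNReal_div (by positivity)]
    simp
  rw [split, ← T.inner_op_op, T.inner_op_self, T.inner_op_self]
  linarith [real_inner_le_norm (T.op (x.toNNReal / 2) f) (T.op (y.toNNReal / 2) f),
    sq_nonneg (‖T.op (x.toNNReal / 2) f‖ - ‖T.op (y.toNNReal / 2) f‖)]

theorem antitoneOn_inner_op :
    AntitoneOn (fun x : ℝ => ⟪T.op x.toNNReal f, f⟫_ℝ) (Set.Ici 0) := by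
  intro x _ y _ hxy
  obtain ⟨s, hs⟩ := exists_add_of_le (Real.toNNReal_le_toNNReal hxy)
  simp only [T.inner_op_self]
  rw [hs, add_div, add_comm, op_add_apply]
  gcongr
  exact T.norm_op_le _ _

theorem approxForm_op {x : ℝ} (hx : 0 ≤ x) (h : ℝ≥0) :
    T.approxForm h (T.op (x / 2).toNNReal f) (T.op (x / 2).toNNReal f) =
      -slope (fun y : ℝ => ⟪T.op y.toNNReal f, f⟫_ℝ) x (x + h) := by
  have halves : (x / 2).toNNReal + (x / 2).toNNReal = x.toNNReal := by
    rw [← Real.toNNReal_add (by positivity) (by positivity), add_halves]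
  rw [approxForm, inner_sub_left, ← op_add_apply, inner_op_op, inner_op_op, add_assoc, halves,
    slope_def_field, add_sub_cancel_left, Real.toNNReal_add hx h.coe_nonneg, Real.toNNReal_coe,
    add_comm h]
  ring

theorem tendsto_approxForm_op {x : ℝ} (hx : 0 < x) :
    Tendsto (fun h => T.approxForm h (T.op (x / 2).toNNReal f) (T.op (x / 2).toNNReal f)) (𝓝[>] 0)
      (𝓝 (-derivWithin (fun y : ℝ => ⟪T.op y.toNNReal f, f⟫_ℝ) (Set.Ioi x) x)) := by
  have hderiv := (T.convexOn_inner_op f).hasDerivWithinAt_rightDeriv_of_mem_interior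
    (show x ∈ interior (Set.Ici 0) by rwa [interior_Ici])
  rw [hasDerivWithinAt_iff_tendsto_slope' Set.self_notMem_Ioi] at hderiv
  have shift : Tendsto (fun h : ℝ≥0 => x + h) (𝓝[>] 0) (𝓝[>] x) := by
    refine tendsto_nhdsWithin_iff.2 ⟨?_, ?_⟩
    · have : Continuous fun h : ℝ≥0 => x + h := by fun_prop
      simpa using (this.tendsto 0).mono_left nhdsWithin_le_nhds
    · filter_upwards [self_mem_nhdsWithin] with h hh
      exact lt_add_of_pos_right x (NNReal.coe_pos.2 hh)
  exact (hderiv.comp shift).neg.congr fun h => (T.approxForm_op f hx.le h).symm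

theorem op_mem_formDomain {t : ℝ≥0} (ht : 0 < t) : T.op t f ∈ T.formDomain := by
  have h := T.tendsto_approxForm_op f (x := 2 * t) (by positivity)
  rw [mul_div_cancel_left₀ _ two_ne_zero, Real.toNNReal_coe] at h
  exact ⟨_, h⟩

theorem hasDerivWithinAt_inner_op {x : ℝ} (hx : 0 < x) :
    HasDerivWithinAt (fun y : ℝ => ⟪T.op y.toNNReal f, f⟫_ℝ)
      (-T.form (T.op (x / 2).toNNReal f) (T.op (x / 2).toNNReal f)) (Set.Ici x) x := by
  rw [form, (T.tendsto_approxForm_op f hx).limUnder_eq, neg_neg, ← hasDerivWithinAt_Ioi_iff_Ici]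
  exact (T.convexOn_inner_op f).hasDerivWithinAt_rightDeriv_of_mem_interior
    (by rwa [interior_Ici])

end Energy

section Nash

variable {α : Type*} [MeasurableSpace α] {μ : Measure α} {T : SymmMarkovSemigroup μ}

/-- The Nash type inequality of exponent `r` and dimension parameter `d` for the Dirichlet form,
`C ‖f‖₂² min {1, (‖f‖₂ / ‖f‖_r) ^ (2 / d)} ≤ Q(f, f)`, written in homogeneous form so that no
normalization of `f` is required. -/
def NashInequality (T : SymmMarkovSemigroup μ) (C r d : ℝ) : Prop :=
  ∀ f ∈ T.formDomain, MemLp f 1 μ →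
    C * (‖f‖ ^ 2 * min 1 ((‖f‖ / lpNorm f (ENNReal.ofReal r) μ) ^ (2 / d))) ≤ T.form f f

theorem tendsto_approxForm_smul {f : Lp ℝ 2 μ} (hf : f ∈ T.formDomain) (c : ℝ) :
    Tendsto (fun t => T.approxForm t (c • f) (c • f)) (𝓝[>] 0) (𝓝 (c ^ 2 * T.form f f)) := by
  obtain ⟨l, hl⟩ := hf
  rw [form, hl.limUnder_eq]
  refine (hl.const_mul (c ^ 2)).congr fun t => ?_
  rw [approxForm, approxForm, map_smul, ← smul_sub, real_inner_smul_left, real_inner_smul_right]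
  ring

theorem form_smul {f : Lp ℝ 2 μ} (hf : f ∈ T.formDomain) (c : ℝ) :
    T.form (c • f) (c • f) = c ^ 2 * T.form f f :=
  (tendsto_approxForm_smul hf c).limUnder_eq

theorem memLp_ofReal_of_one {f : Lp ℝ 2 μ} (hf : MemLp f 1 μ) {r : ℝ} (hr₁ : 1 ≤ r)
    (hr₂ : r ≤ 2) : MemLp f (ENNReal.ofReal r) μ :=
  memLp_of_le_of_le one_pos hr₁ hr₂ (by simpa using hf) (by simpa using Lp.memLp f)

theorem nashInequality_of_norm_eq_one {r d C : ℝ} (hr₁ : 1 ≤ r) (hr₂ : r ≤ 2)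
    (hNash : ∀ f : Lp ℝ 2 μ, f ∈ T.formDomain → MemLp f 1 μ →
      eLpNorm f (ENNReal.ofReal r) μ = 1 →
      C * ‖f‖ ^ 2 * min 1 (‖f‖ ^ (2 / d)) ≤ T.form f f) :
    T.NashInequality C r d := by
  intro f hf hf₁
  obtain rfl | hf₀ := eq_or_ne f 0
  · have := form_smul hf 0
    simp_all
  have hfr := memLp_ofReal_of_one hf₁ hr₁ hr₂
  set R := lpNorm f (ENNReal.ofReal r) μ
  have hR : 0 < R := lpNorm_pos_of_ne_zero hf₀ (by simpa using one_pos.trans_le hr₁) hfr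
  have normalized : eLpNorm (R⁻¹ • f : Lp ℝ 2 μ) (ENNReal.ofReal r) μ = 1 := by
    rw [eLpNorm_congr_ae (Lp.coeFn_smul _ _), eLpNorm_const_smul, ← ofReal_lpNorm hfr,
      Real.enorm_of_nonneg (by positivity), ← ENNReal.ofReal_mul (by positivity),
      inv_mul_cancel₀ hR.ne', ENNReal.ofReal_one]
  have := hNash (R⁻¹ • f) ⟨_, tendsto_approxForm_smul hf _⟩
    ((memLp_congr_ae (Lp.coeFn_smul _ _)).2 (hf₁.const_smul _)) normalized
  rw [form_smul hf, norm_smul, Real.norm_of_nonneg (by positivity), inv_mul_eq_div] at this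
  refine le_of_mul_le_mul_left (a := R⁻¹ ^ 2) (le_of_eq_of_le ?_ this) (by positivity)
  ring

theorem NashInequality.exponent_one {C r d : ℝ} (h : T.NashInequality C r d) (hC : 0 ≤ C)
    (hr₁ : 1 ≤ r) (hr₂ : r < 2) (hd : 0 < d) : T.NashInequality C 1 (d * r / (2 - r)) := by
  intro f hf hf₁
  refine le_trans ?_ (h f hf hf₁)
  obtain rfl | hf₀ := eq_or_ne f 0
  · simp
  have hr : 0 < r := by linarith
  have h2r : 0 < 2 - r := by linarith
  have norm_pos : 0 < ‖f‖ := norm_pos_iff.2 hf₀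
  have one_norm_pos : 0 < lpNorm f 1 μ := lpNorm_pos_of_ne_zero hf₀ one_ne_zero hf₁
  have hfr : MemLp f (ENNReal.ofReal r) μ := memLp_ofReal_of_one hf₁ hr₁ hr₂.le
  have r_norm_pos : 0 < lpNorm f (ENNReal.ofReal r) μ :=
    lpNorm_pos_of_ne_zero hf₀ (by simpa using hr) hfr
  have ratio_le : (‖f‖ / lpNorm f 1 μ) ^ ((2 - r) / r) ≤
      ‖f‖ / lpNorm f (ENNReal.ofReal r) μ := by
    have interp := lpNorm_le_rpow_mul_rpow (θ := (2 - r) / r) one_pos hr₁ hr₂.le (by positivity)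
      ((div_le_one hr).2 (by linarith)) (by field_simp; ring)
      (by simpa using hf₁) (by simpa using Lp.memLp f)
    rw [ENNReal.ofReal_one, ENNReal.ofReal_ofNat, ← norm_eq_lpNorm, Real.rpow_sub norm_pos,
      Real.rpow_one, mul_div_left_comm, ← Real.div_rpow one_norm_pos.le norm_pos.le, ← inv_div,
      Real.inv_rpow (by positivity), ← div_eq_mul_inv] at interp
    exact (le_div_comm₀ r_norm_pos (by positivity)).1 interp
  gcongr C * (_ * min 1 ?_)
  calc (‖f‖ / lpNorm f (ENNReal.ofReal 1) μ) ^ (2 / (d * r / (2 - r)))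
      = ((‖f‖ / lpNorm f 1 μ) ^ ((2 - r) / r)) ^ (2 / d) := by
        rw [ENNReal.ofReal_one, ← Real.rpow_mul (by positivity)]
        congr 1
        field_simp
    _ ≤ (‖f‖ / lpNorm f (ENNReal.ofReal r) μ) ^ (2 / d) := by gcongr

theorem NashInequality.le_form_of_lpNorm_one_le {C d K : ℝ} (h : T.NashInequality C 1 d)
    (hC : 0 ≤ C) (hd : 0 < d) {f : Lp ℝ 2 μ} (hf : f ∈ T.formDomain) (hf₁ : MemLp f 1 μ)
    (hK : lpNorm f 1 μ ≤ K) :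
    C * (‖f‖ ^ 2 * min 1 ((‖f‖ ^ 2 / K ^ 2) ^ (1 / d))) ≤ T.form f f := by
  refine le_trans ?_ (h f hf hf₁)
  obtain rfl | hf₀ := eq_or_ne f 0
  · simp
  have one_norm_pos : 0 < lpNorm f 1 μ := lpNorm_pos_of_ne_zero hf₀ one_ne_zero hf₁
  have K_pos : 0 < K := one_norm_pos.trans_le hK
  gcongr C * (_ * min 1 ?_)
  calc (‖f‖ ^ 2 / K ^ 2) ^ (1 / d) = (‖f‖ / K) ^ (2 / d) := by
        rw [← div_pow, ← Real.rpow_two, ← Real.rpow_mul (by positivity), mul_one_div]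
    _ ≤ (‖f‖ / lpNorm f (ENNReal.ofReal 1) μ) ^ (2 / d) := by
        rw [ENNReal.ofReal_one]
        gcongr

theorem memLp_one_op (T : SymmMarkovSemigroup μ) (t : ℝ≥0) {f : Lp ℝ 2 μ} (hf : MemLp f 1 μ) :
    MemLp (T.op t f) 1 μ :=
  ⟨Lp.aestronglyMeasurable _, (T.eLpNorm_one_op_le t f hf).trans_lt hf.2⟩

theorem lpNorm_one_op_le (T : SymmMarkovSemigroup μ) (t : ℝ≥0) {f : Lp ℝ 2 μ}
    (hf : MemLp f 1 μ) : lpNorm (T.op t f) 1 μ ≤ lpNorm f 1 μ := by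
  rw [← toReal_eLpNorm hf.1, ← toReal_eLpNorm (Lp.aestronglyMeasurable _)]
  exact ENNReal.toReal_mono hf.eLpNorm_ne_top (T.eLpNorm_one_op_le t f hf)

theorem NashInequality.norm_op_sq_le {C d : ℝ} (h : T.NashInequality C 1 d) (hC : 0 < C)
    (hd : 0 < d) {f : Lp ℝ 2 μ} (hf : MemLp f 1 μ) {t : ℝ≥0} (ht : 0 < t) :
    ‖T.op t f‖ ^ 2 ≤ (3 * d / (2 * C * t)) ^ d * lpNorm f 1 μ ^ 2 +
      Real.exp (-(2 * C / 3) * t) * ‖f‖ ^ 2 := by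
  obtain rfl | hf₀ := eq_or_ne f 0
  · rw [map_zero, norm_zero, zero_pow two_ne_zero]
    positivity
  have key := le_add_of_deriv_right_le_min (t := 2 * t) hC hd
    (pow_pos (lpNorm_pos_of_ne_zero hf₀ one_ne_zero hf) 2) (by positivity)
    (T.continuous_inner_op f).continuousOn
    ((T.antitoneOn_inner_op f).mono Set.Icc_subset_Ici_self) (by simp [inner_op_self])
    (fun x hx => T.hasDerivWithinAt_inner_op f hx.1) fun x hx => by
      rw [T.inner_op_self, neg_mul, neg_le_neg_iff,
        show x.toNNReal / 2 = (x / 2).toNNReal by rw [Real.toNNReal_div hx.1.le]; simp]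
      exact h.le_form_of_lpNorm_one_le hC.le hd
        (T.op_mem_formDomain f (Real.toNNReal_pos.2 (half_pos hx.1))) (T.memLp_one_op _ hf)
        (T.lpNorm_one_op_le _ hf)
  have double : (2 * t : ℝ).toNNReal / 2 = t := by
    rw [Real.toNNReal_mul zero_le_two, Real.toNNReal_coe]
    simp
  simp only [inner_op_self, double, Real.toNNReal_zero, T.op_zero,
    ContinuousLinearMap.id_apply, real_inner_self_eq_norm_sq] at key
  convert key using 4 <;> ring

theorem NashInequality.norm_op_le {C d : ℝ} (h : T.NashInequality C 1 d) (hC : 0 < C)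
    (hd : 0 < d) {f : Lp ℝ 2 μ} (hf : MemLp f 1 μ) {t : ℝ≥0} (ht : 0 < t) :
    ‖T.op t f‖ ≤ (3 * d / (2 * C * t)) ^ (d / 2) * lpNorm f 1 μ +
      Real.exp (-(C / 3) * t) * ‖f‖ := by
  have hL : 0 ≤ lpNorm f 1 μ := lpNorm_nonneg
  have power_sq : (3 * d / (2 * C * t)) ^ d = ((3 * d / (2 * C * t)) ^ (d / 2)) ^ 2 := by
    rw [← Real.rpow_two, ← Real.rpow_mul (by positivity), div_mul_cancel₀ _ two_ne_zero]
  have exp_sq : Real.exp (-(2 * C / 3) * t) = Real.exp (-(C / 3) * t) ^ 2 := by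
    rw [← Real.exp_nat_mul]
    congr 1
    push_cast
    ring
  refine (pow_le_pow_iff_left₀ (norm_nonneg _) (by positivity) two_ne_zero).1
    ((h.norm_op_sq_le hC hd hf ht).trans ?_)
  rw [power_sq, exp_sq, ← mul_pow, ← mul_pow]
  exact pow_add_pow_le (by positivity) (by positivity) two_ne_zero

end Nash

end SymmMarkovSemigroup

theorem rpow_mul_rpow_le_tangent {θ η κ κ' a b : ℝ} (hθ : 0 ≤ θ) (hη : 0 ≤ η) (hθη : θ + η ≤ 1)
    (hκ : 0 ≤ κ) (hκ' : 0 ≤ κ') (ha : 0 ≤ a) (hb : 0 ≤ b) :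
    κ ^ θ * κ' ^ η * (a ^ θ * b ^ η) ≤ θ * (κ * a) + η * (κ' * b) + (1 - θ - η) := by
  have := Real.geom_mean_le_arith_mean3_weighted hθ hη (by linarith : 0 ≤ 1 - θ - η)
    (mul_nonneg hκ ha) (mul_nonneg hκ' hb) zero_le_one (by ring)
  rw [Real.mul_rpow hκ ha, Real.mul_rpow hκ' hb, Real.one_rpow] at this
  linarith

theorem le_rpow_mul_rpow_of_forall_rat {θ η a b y : ℝ} (hθ : 0 ≤ θ) (hη : 0 ≤ η)
    (ha : 0 ≤ a) (hb : 0 ≤ b)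
    (h : ∀ κ κ' : ℚ, |(κ : ℝ)| ^ θ * |(κ' : ℝ)| ^ η * y ≤
      θ * (|(κ : ℝ)| * a) + η * (|(κ' : ℝ)| * b) + (1 - θ - η)) :
    y ≤ a ^ θ * b ^ η := by
  have real_h (z : ℝ × ℝ) :
      |z.1| ^ θ * |z.2| ^ η * y ≤ θ * (|z.1| * a) + η * (|z.2| * b) + (1 - θ - η) := by
    refine (Rat.denseRange_cast.prodMap Rat.denseRange_cast).induction_on z
      (isClosed_le ?_ (by fun_prop)) fun κ => h κ.1 κ.2
    exact ((continuous_fst.abs.rpow_const fun _ => .inr hθ).mul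
      (continuous_snd.abs.rpow_const fun _ => .inr hη)).mul_const y
  have shifted {δ : ℝ} (hδ : 0 < δ) : y ≤ (a + δ) ^ θ * (b + δ) ^ η := by
    have key := real_h ((a + δ)⁻¹, (b + δ)⁻¹)
    have ratio_le {c : ℝ} (hc : 0 ≤ c) : (c + δ)⁻¹ * c ≤ 1 :=
      inv_mul_le_one_of_le₀ (by linarith) (by positivity)
    have rhs_le_one : θ * ((a + δ)⁻¹ * a) + η * ((b + δ)⁻¹ * b) + (1 - θ - η) ≤ 1 := by
      linarith [mul_le_of_le_one_right hθ (ratio_le ha), mul_le_of_le_one_right hη (ratio_le hb)]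
    rw [abs_of_pos (by positivity), abs_of_pos (by positivity), Real.inv_rpow (by positivity),
      Real.inv_rpow (by positivity), ← mul_inv, inv_mul_eq_div] at key
    exact (div_le_one (by positivity)).1 (key.trans rhs_le_one)
  have limit : Tendsto (fun δ : ℝ => (a + δ) ^ θ * (b + δ) ^ η) (𝓝[>] 0) (𝓝 (a ^ θ * b ^ η)) := by
    have : Continuous fun δ : ℝ => (a + δ) ^ θ * (b + δ) ^ η :=
      ((continuous_const.add continuous_id).rpow_const fun _ => .inr hθ).mul
        ((continuous_const.add continuous_id).rpow_const fun _ => .inr hη)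
    simpa using (this.tendsto 0).mono_left nhdsWithin_le_nhds
  exact ge_of_tendsto limit (eventually_mem_nhdsWithin.mono fun _ => shifted)

theorem Lp_coeFn_smul_add_smul {α : Type*} [MeasurableSpace α] {μ : Measure α} {p : ℝ≥0∞}
    (a b : ℝ) (f g : Lp ℝ p μ) : a • f + b • g =ᵐ[μ] fun x => a * f x + b * g x := by
  filter_upwards [Lp.coeFn_add (a • f) (b • g), Lp.coeFn_smul a f, Lp.coeFn_smul b g]
    with x hadd hf hg
  rw [hadd, Pi.add_apply, hf, hg, Pi.smul_apply, Pi.smul_apply, smul_eq_mul, smul_eq_mul]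

namespace SymmMarkovSemigroup

section Order

variable {α : Type*} [MeasurableSpace α] {μ : Measure α} (T : SymmMarkovSemigroup μ) (t : ℝ≥0)

theorem op_nonneg {f : Lp ℝ 2 μ} (hf : 0 ≤ f) : 0 ≤ T.op t f := by
  rw [← Lp.coeFn_nonneg] at hf ⊢
  refine AEFinStronglyMeasurable.ae_nonneg_of_forall_setIntegral_nonneg
    (Lp.finStronglyMeasurable _ (by norm_num) (by norm_num)).aefinStronglyMeasurable
    (fun s _ hμs => integrableOn_Lp_of_measure_ne_top _ one_le_two hμs.ne) fun s hs hμs => ?_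
  have indicator_mem := T.markov t (indicatorConstLp 2 hs hμs.ne 1) <| by
    filter_upwards [indicatorConstLp_coeFn (p := 2) (hs := hs) (hμs := hμs.ne) (c := (1 : ℝ))]
      with x hx
    rw [hx]
    by_cases h : x ∈ s <;> simp [h]
  rw [← L2.inner_indicatorConstLp_one hs hμs.ne, ← T.symm, L2.inner_def]
  refine integral_nonneg_of_ae ?_
  filter_upwards [indicator_mem, hf] with x hx hfx
  simpa using mul_nonneg hfx hx.1

theorem op_mono {f g : Lp ℝ 2 μ} (h : f ≤ g) : T.op t f ≤ T.op t g := by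
  have := T.op_nonneg t (sub_nonneg.2 h)
  rwa [map_sub, sub_nonneg] at this

theorem abs_op_le (f : Lp ℝ 2 μ) : |T.op t f| ≤ T.op t |f| := by
  refine abs_le'.2 ⟨T.op_mono t (le_abs_self f), ?_⟩
  rw [← map_neg]
  exact T.op_mono t (neg_le_abs f)

theorem op_ae_le_const {f : Lp ℝ 2 μ} {c : ℝ} (hc : 0 ≤ c) (hf : ∀ᵐ x ∂μ, f x ≤ c) :
    ∀ᵐ x ∂μ, T.op t f x ≤ c := by
  obtain rfl | hc := hc.eq_or_lt
  · have hf : f ≤ 0 := by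
      rw [← Lp.coeFn_le]
      filter_upwards [hf, Lp.coeFn_zero ℝ 2 μ] with x hx h0
      rwa [h0]
    have hTf := T.op_mono t hf
    rw [map_zero, ← Lp.coeFn_le] at hTf
    filter_upwards [hTf, Lp.coeFn_zero ℝ 2 μ] with x hx h0
    rwa [h0] at hx
  have positive_part := T.markov t (c⁻¹ • (f ⊔ 0)) <| by
    filter_upwards [hf, Lp.coeFn_smul c⁻¹ (f ⊔ 0), Lp.coeFn_sup f 0, Lp.coeFn_zero ℝ 2 μ]
      with x hx hsmul hsup hzero
    rw [hsmul, Pi.smul_apply, hsup, Pi.sup_apply, hzero, Pi.zero_apply, smul_eq_mul,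
      inv_mul_le_one₀ hc]
    exact ⟨by positivity, sup_le hx hc.le⟩
  have hle := T.op_mono t (le_sup_left : f ≤ f ⊔ 0)
  rw [← Lp.coeFn_le] at hle
  rw [map_smul] at positive_part
  filter_upwards [positive_part, hle, Lp.coeFn_smul c⁻¹ (T.op t (f ⊔ 0))] with x hx hxle hsmul
  rw [hsmul, Pi.smul_apply, smul_eq_mul, inv_mul_le_one₀ hc] at hx
  exact hxle.trans hx.2

theorem op_ae_le_add_const {f g : Lp ℝ 2 μ} {c : ℝ} (hc : 0 ≤ c)
    (hfg : ∀ᵐ x ∂μ, f x ≤ g x + c) : ∀ᵐ x ∂μ, T.op t f x ≤ T.op t g x + c := by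
  have := T.op_ae_le_const t (f := f - g) hc <| by
    filter_upwards [hfg, Lp.coeFn_sub f g] with x hx hsub
    rwa [hsub, Pi.sub_apply, sub_le_iff_le_add']
  rw [map_sub] at this
  filter_upwards [this, Lp.coeFn_sub (T.op t f) (T.op t g)] with x hx hsub
  rwa [hsub, Pi.sub_apply, sub_le_iff_le_add'] at hx

theorem op_ae_le_rpow_mul_rpow {f g h : Lp ℝ 2 μ} {θ η : ℝ} (hθ : 0 ≤ θ) (hη : 0 ≤ η)
    (hθη : θ + η ≤ 1) (hf : 0 ≤ f) (hg : 0 ≤ g) (hle : ∀ᵐ x ∂μ, h x ≤ f x ^ θ * g x ^ η) :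
    ∀ᵐ x ∂μ, T.op t h x ≤ T.op t f x ^ θ * T.op t g x ^ η := by
  -- By AM-GM `f ^ θ * g ^ η` is the infimum of the affine functions of `f` and `g` on the right
  -- below; rational slopes suffice, so that only countably many null sets are discarded.
  have tangent (κ κ' : ℚ) : ∀ᵐ x ∂μ, |(κ : ℝ)| ^ θ * |(κ' : ℝ)| ^ η * T.op t h x ≤
      θ * (|(κ : ℝ)| * T.op t f x) + η * (|(κ' : ℝ)| * T.op t g x) + (1 - θ - η) := by
    have hTle := T.op_ae_le_add_const t (f := (|(κ : ℝ)| ^ θ * |(κ' : ℝ)| ^ η) • h)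
      (g := (θ * |(κ : ℝ)|) • f + (η * |(κ' : ℝ)|) • g) (c := 1 - θ - η) (by linarith) <| by
      filter_upwards [hle, (Lp.coeFn_nonneg _).2 hf, (Lp.coeFn_nonneg _).2 hg,
        Lp.coeFn_smul (|(κ : ℝ)| ^ θ * |(κ' : ℝ)| ^ η) h, Lp_coeFn_smul_add_smul _ _ f g]
        with x hx hfx hgx hsmul hcomb
      rw [hsmul, hcomb, Pi.smul_apply, smul_eq_mul, mul_assoc θ, mul_assoc η]
      refine le_trans ?_
        (rpow_mul_rpow_le_tangent hθ hη hθη (abs_nonneg _) (abs_nonneg _) hfx hgx)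
      gcongr
    simp only [map_add, map_smul] at hTle
    filter_upwards [hTle, Lp.coeFn_smul (|(κ : ℝ)| ^ θ * |(κ' : ℝ)| ^ η) (T.op t h),
      Lp_coeFn_smul_add_smul _ _ (T.op t f) (T.op t g)] with x hx hsmul hcomb
    rw [hsmul, hcomb, Pi.smul_apply, smul_eq_mul] at hx
    linarith
  filter_upwards [ae_all_iff.2 fun κ => ae_all_iff.2 (tangent κ),
    (Lp.coeFn_nonneg _).2 (T.op_nonneg t hf), (Lp.coeFn_nonneg _).2 (T.op_nonneg t hg)]
    with x hx hfx hgx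
  exact le_rpow_mul_rpow_of_forall_rat hθ hη hfx hgx hx

end Order

end SymmMarkovSemigroup

section TestFunctions

variable {α : Type*} [MeasurableSpace α] {μ : Measure α}

theorem eLpNorm_rpow_of_ae_nonneg {f : α → ℝ} (hf : ∀ᵐ x ∂μ, 0 ≤ f x) {p m : ℝ} (hp : 0 ≤ p)
    (hm : 0 < m) :
    eLpNorm (fun x => f x ^ m) (ENNReal.ofReal p) μ = eLpNorm f (ENNReal.ofReal (p * m)) μ ^ m := by
  rw [ENNReal.ofReal_mul hp, ← eLpNorm_norm_rpow f hm]
  refine eLpNorm_congr_ae ?_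
  filter_upwards [hf] with x hx
  rw [Real.norm_of_nonneg hx]

/-- The nonnegative elements of `L¹ ∩ L^∞`, regarded as elements of `L²`. The class is stable under
the semigroup and under powers with exponent at least one. -/
structure IsTest (f : Lp ℝ 2 μ) : Prop where
  nonneg : 0 ≤ f
  memLp_one : MemLp f 1 μ
  memLp_top : MemLp f ∞ μ

namespace IsTest

variable {f : Lp ℝ 2 μ}

theorem ae_nonneg (hf : IsTest f) : ∀ᵐ x ∂μ, 0 ≤ f x := (Lp.coeFn_nonneg f).2 hf.nonneg

theorem ae_le_lpNorm_top (hf : IsTest f) : ∀ᵐ x ∂μ, f x ≤ lpNorm f ∞ μ := by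
  filter_upwards [ae_le_lpNorm_exponent_top hf.memLp_top] with x hx
  exact (le_abs_self _).trans hx

theorem exists_ae_eq_of_le_mul (hf : IsTest f) {φ : α → ℝ} (hφ : AEStronglyMeasurable φ μ)
    {C : ℝ} (hle : ∀ᵐ x ∂μ, 0 ≤ φ x ∧ φ x ≤ C * f x) : ∃ g : Lp ℝ 2 μ, IsTest g ∧ g =ᵐ[μ] φ := by
  have norm_le : ∀ᵐ x ∂μ, ‖φ x‖ ≤ C * ‖f x‖ := by
    filter_upwards [hle, hf.ae_nonneg] with x hx hfx
    rw [Real.norm_of_nonneg hx.1, Real.norm_of_nonneg hfx]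
    exact hx.2
  have memLp {p : ℝ≥0∞} (hp : MemLp f p μ) : MemLp φ p μ := hp.of_le_mul hφ norm_le
  have eq := (memLp (Lp.memLp f)).coeFn_toLp
  refine ⟨(memLp (Lp.memLp f)).toLp φ, ⟨(Lp.coeFn_nonneg _).1 ?_, ?_, ?_⟩, eq⟩
  · filter_upwards [eq, hle] with x hx hφx
    rw [hx]
    exact hφx.1
  · exact (memLp_congr_ae eq).2 (memLp hf.memLp_one)
  · exact (memLp_congr_ae eq).2 (memLp hf.memLp_top)

theorem exists_ae_eq_rpow (hf : IsTest f) {m : ℝ} (hm : 1 ≤ m) :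
    ∃ g : Lp ℝ 2 μ, IsTest g ∧ g =ᵐ[μ] fun x => f x ^ m := by
  refine hf.exists_ae_eq_of_le_mul (C := lpNorm f ∞ μ ^ (m - 1))
    ((Lp.aestronglyMeasurable f).aemeasurable.pow_const m).aestronglyMeasurable ?_
  filter_upwards [hf.ae_nonneg, hf.ae_le_lpNorm_top] with x hx hxle
  refine ⟨Real.rpow_nonneg hx m, ?_⟩
  calc f x ^ m = f x ^ (m - 1) * f x := by
        rw [← Real.rpow_add_one' hx (by linarith), sub_add_cancel]
    _ ≤ lpNorm f ∞ μ ^ (m - 1) * f x := by gcongr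

theorem memLp (hf : IsTest f) {p : ℝ} (hp : 1 ≤ p) : MemLp f (ENNReal.ofReal p) μ := by
  have hp₀ : 0 < p := one_pos.trans_le hp
  obtain ⟨g, hg, hgf⟩ := hf.exists_ae_eq_rpow hp
  have := hg.memLp_one.2
  rw [← ENNReal.ofReal_one, eLpNorm_congr_ae hgf, eLpNorm_rpow_of_ae_nonneg hf.ae_nonneg
    zero_le_one hp₀, one_mul, ENNReal.rpow_lt_top_iff_of_pos hp₀] at this
  exact ⟨Lp.aestronglyMeasurable f, this⟩

theorem add (hf : IsTest f) {g : Lp ℝ 2 μ} (hg : IsTest g) : IsTest (f + g) where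
  nonneg := add_nonneg hf.nonneg hg.nonneg
  memLp_one := (memLp_congr_ae (Lp.coeFn_add f g)).2 (hf.memLp_one.add hg.memLp_one)
  memLp_top := (memLp_congr_ae (Lp.coeFn_add f g)).2 (hf.memLp_top.add hg.memLp_top)

theorem smul (hf : IsTest f) {c : ℝ} (hc : 0 ≤ c) : IsTest (c • f) where
  nonneg := by
    rw [← Lp.coeFn_nonneg]
    filter_upwards [Lp.coeFn_smul c f, hf.ae_nonneg] with x hx hfx
    rw [hx]
    exact mul_nonneg hc hfx
  memLp_one := (memLp_congr_ae (Lp.coeFn_smul c f)).2 (hf.memLp_one.const_smul c)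
  memLp_top := (memLp_congr_ae (Lp.coeFn_smul c f)).2 (hf.memLp_top.const_smul c)

theorem op (hf : IsTest f) (T : SymmMarkovSemigroup μ) (t : ℝ≥0) : IsTest (T.op t f) where
  nonneg := T.op_nonneg t hf.nonneg
  memLp_one := T.memLp_one_op t hf.memLp_one
  memLp_top := by
    refine memLp_top_of_bound (Lp.aestronglyMeasurable _) (lpNorm f ∞ μ) ?_
    filter_upwards [(Lp.coeFn_nonneg _).2 (T.op_nonneg t hf.nonneg),
      T.op_ae_le_const t lpNorm_nonneg hf.ae_le_lpNorm_top] with x hx hle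
    rwa [Real.norm_of_nonneg hx]

theorem eLpNorm_op_le_rpow_mul_rpow {v : Lp ℝ 2 μ} (hv : IsTest v) (T : SymmMarkovSemigroup μ)
    (t : ℝ≥0) {g : Lp ℝ 2 μ} {p q s θ η : ℝ} (hp : 0 < p) (hq : 0 < q) (hs : 0 < s)
    (hθ : 0 ≤ θ) (hη : 0 ≤ η) (hθη : θ + η ≤ 1) (hpqs : θ / p + η / q = 1 / s)
    (hf : IsTest f) (hg : IsTest g) (hle : ∀ᵐ x ∂μ, v x ≤ f x ^ θ * g x ^ η) :
    eLpNorm (T.op t v) (ENNReal.ofReal s) μ ≤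
      eLpNorm (T.op t f) (ENNReal.ofReal p) μ ^ θ *
        eLpNorm (T.op t g) (ENNReal.ofReal q) μ ^ η := by
  refine eLpNorm_le_rpow_mul_rpow hp hq hs hθ hη hpqs (Lp.aestronglyMeasurable _)
    (Lp.aestronglyMeasurable _) ?_
  filter_upwards [T.op_ae_le_rpow_mul_rpow t hθ hη hθη hf.nonneg hg.nonneg hle,
    (hv.op T t).ae_nonneg, (hf.op T t).ae_nonneg, (hg.op T t).ae_nonneg] with x hx hvx hfx hgx
  rw [Real.enorm_of_nonneg hvx, Real.enorm_of_nonneg hfx, Real.enorm_of_nonneg hgx,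
    ENNReal.ofReal_rpow_of_nonneg hfx hθ, ENNReal.ofReal_rpow_of_nonneg hgx hη,
    ← ENNReal.ofReal_mul (by positivity)]
  exact ENNReal.ofReal_le_ofReal hx

theorem eLpNorm_op_rpow_le (hf : IsTest f) (T : SymmMarkovSemigroup μ) (t : ℝ≥0)
    {g : Lp ℝ 2 μ} {s m : ℝ} (hs : 0 < s) (hm : 1 ≤ m) (hg : IsTest g)
    (hgf : g =ᵐ[μ] fun x => f x ^ m) :
    eLpNorm (T.op t f) (ENNReal.ofReal (s * m)) μ ^ m ≤
      eLpNorm (T.op t g) (ENNReal.ofReal s) μ := by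
  have hm₀ : 0 < m := one_pos.trans_le hm
  have jensen := hf.eLpNorm_op_le_rpow_mul_rpow T t (θ := 1 / m) (η := 0) hs hs
    (mul_pos hs hm₀) (by positivity) le_rfl (by rwa [add_zero, div_le_one hm₀])
    (by field_simp; simp) hg hg <| by
    filter_upwards [hgf, hf.ae_nonneg] with x hx hfx
    rw [hx, Real.rpow_zero, mul_one, ← Real.rpow_mul hfx, mul_one_div_cancel hm₀.ne',
      Real.rpow_one]
  rwa [ENNReal.rpow_zero, mul_one, one_div, ENNReal.le_rpow_inv_iff hm₀] at jensen

theorem eLpNorm_op_le (hf : IsTest f) (T : SymmMarkovSemigroup μ) (t : ℝ≥0) {p : ℝ} (hp : 1 ≤ p) :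
    eLpNorm (T.op t f) (ENNReal.ofReal p) μ ≤ eLpNorm f (ENNReal.ofReal p) μ := by
  have hp₀ : 0 < p := one_pos.trans_le hp
  obtain ⟨g, hg, hgf⟩ := hf.exists_ae_eq_rpow hp
  refine (ENNReal.rpow_le_rpow_iff hp₀).1 ?_
  calc eLpNorm (T.op t f) (ENNReal.ofReal p) μ ^ p
      ≤ eLpNorm (T.op t g) 1 μ := by
        simpa using hf.eLpNorm_op_rpow_le T t one_pos hp hg hgf
    _ ≤ eLpNorm g 1 μ := T.eLpNorm_one_op_le t g hg.memLp_one
    _ = eLpNorm f (ENNReal.ofReal p) μ ^ p := by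
        simpa [eLpNorm_congr_ae hgf] using eLpNorm_rpow_of_ae_nonneg hf.ae_nonneg zero_le_one hp₀

end IsTest

end TestFunctions

section Interpolation

variable {α : Type*} [MeasurableSpace α] {μ : Measure α}

theorem le_rpow_mul_min_rpow {θ m s a b x : ℝ} (hθ : 0 ≤ θ) (hθm : θ + m = 1)
    (hθms : θ * s + m * (s / 2) = 1) (ha : 0 < a) (hb : 0 < b) (hab : a ^ θ * b ^ m = 1)
    (hx : 0 ≤ x) : x ≤ (x + a * x ^ s) ^ θ * min x (b * x ^ (s / 2)) ^ m := by
  obtain rfl | hx := hx.eq_or_lt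
  · positivity
  obtain h | h := min_choice x (b * x ^ (s / 2)) <;> rw [h]
  · calc x = x ^ θ * x ^ m := by rw [← Real.rpow_add hx, hθm, Real.rpow_one]
      _ ≤ (x + a * x ^ s) ^ θ * x ^ m := by gcongr; exact le_add_of_nonneg_right (by positivity)
  · calc x = (a ^ θ * b ^ m) * x ^ (θ * s + m * (s / 2)) := by
          rw [hab, hθms, one_mul, Real.rpow_one]
      _ = (a * x ^ s) ^ θ * (b * x ^ (s / 2)) ^ m := by
          rw [Real.mul_rpow ha.le (by positivity), Real.mul_rpow hb.le (by positivity),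
            ← Real.rpow_mul hx.le, ← Real.rpow_mul hx.le, Real.rpow_add hx, mul_comm θ, mul_comm m]
          ring
      _ ≤ (x + a * x ^ s) ^ θ * (b * x ^ (s / 2)) ^ m := by
          gcongr
          exact le_add_of_nonneg_left hx.le

theorem exists_balanced_weights {θ m s N V : ℝ} (hm : 0 < m)
    (hθms : θ * s + m * (s / 2) = 1) (hN : 0 < N) (hV : 0 < V) :
    ∃ a b : ℝ, 0 < a ∧ 0 < b ∧ a ^ θ * b ^ m = 1 ∧ a * V ^ s = N ∧
      N ^ θ * (b * V ^ (s / 2)) ^ m = V := by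
  set a := N / V ^ s
  have ha : 0 < a := by positivity
  have haV : a * V ^ s = N := div_mul_cancel₀ _ (by positivity)
  have hab : a ^ θ * (a ^ (-θ / m)) ^ m = 1 := by
    rw [← Real.rpow_mul ha.le, div_mul_cancel₀ _ hm.ne', ← Real.rpow_add ha, add_neg_cancel,
      Real.rpow_zero]
  refine ⟨a, a ^ (-θ / m), ha, by positivity, hab, haV, ?_⟩
  rw [← haV, Real.mul_rpow ha.le (by positivity), Real.mul_rpow (by positivity) (by positivity),
    mul_mul_mul_comm, hab, one_mul, ← Real.rpow_mul hV.le, ← Real.rpow_mul hV.le,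
    ← Real.rpow_add hV, mul_comm s, mul_comm (s / 2), hθms, Real.rpow_one]

theorem IsTest.exists_ae_eq_add_mul_rpow {v : Lp ℝ 2 μ} (hv : IsTest v) {a s : ℝ} (ha : 0 ≤ a)
    (hs : 1 ≤ s) :
    ∃ f : Lp ℝ 2 μ, IsTest f ∧ (f =ᵐ[μ] fun x => v x + a * v x ^ s) ∧
      eLpNorm f 1 μ ≤
        eLpNorm v 1 μ + ENNReal.ofReal a * eLpNorm v (ENNReal.ofReal s) μ ^ s := by
  have hs₀ : 0 < s := one_pos.trans_le hs
  obtain ⟨w, hw, hwv⟩ := hv.exists_ae_eq_rpow hs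
  refine ⟨v + a • w, hv.add (hw.smul ha), ?_, ?_⟩
  · filter_upwards [hwv, Lp.coeFn_add v (a • w), Lp.coeFn_smul a w] with x hx hadd hsmul
    rw [hadd, Pi.add_apply, hsmul, Pi.smul_apply, smul_eq_mul, hx]
  · have norm_rpow := eLpNorm_rpow_of_ae_nonneg hv.ae_nonneg zero_le_one hs₀
    rw [ENNReal.ofReal_one, one_mul] at norm_rpow
    rw [eLpNorm_congr_ae (Lp.coeFn_add v (a • w)), ← Real.enorm_of_nonneg ha, ← norm_rpow,
      ← eLpNorm_congr_ae hwv, ← eLpNorm_const_smul, ← eLpNorm_congr_ae (Lp.coeFn_smul a w)]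
    exact eLpNorm_add_le (Lp.aestronglyMeasurable _) (Lp.aestronglyMeasurable _) le_rfl

theorem IsTest.exists_ae_eq_min_mul_rpow {v : Lp ℝ 2 μ} (hv : IsTest v) {b s : ℝ} (hb : 0 ≤ b)
    (hs : 0 < s) :
    ∃ g : Lp ℝ 2 μ, IsTest g ∧ (g =ᵐ[μ] fun x => min (v x) (b * v x ^ (s / 2))) ∧
      eLpNorm g 1 μ ≤ eLpNorm v 1 μ ∧
      eLpNorm g 2 μ ≤ ENNReal.ofReal b * eLpNorm v (ENNReal.ofReal s) μ ^ (s / 2) := by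
  have rpow_meas : AEStronglyMeasurable (fun x => v x ^ (s / 2)) μ :=
    ((Lp.aestronglyMeasurable v).aemeasurable.pow_const _).aestronglyMeasurable
  obtain ⟨g, hg, hgv⟩ := hv.exists_ae_eq_of_le_mul (C := 1)
    ((Lp.aestronglyMeasurable v).inf (rpow_meas.const_mul b)) <| by
    filter_upwards [hv.ae_nonneg] with x hx
    rw [one_mul]
    exact ⟨le_min hx (by positivity), min_le_left _ _⟩
  refine ⟨g, hg, hgv, eLpNorm_mono_ae ?_, ?_⟩
  · filter_upwards [hgv, hg.ae_nonneg, hv.ae_nonneg] with x hx hgx hvx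
    rw [Real.norm_of_nonneg hgx, Real.norm_of_nonneg hvx, hx]
    exact min_le_left _ _
  · have norm_rpow := eLpNorm_rpow_of_ae_nonneg hv.ae_nonneg zero_le_two (half_pos hs)
    rw [mul_div_cancel₀ s two_ne_zero, ENNReal.ofReal_ofNat] at norm_rpow
    rw [← Real.enorm_of_nonneg hb, ← norm_rpow, ← eLpNorm_const_smul]
    refine eLpNorm_mono_ae ?_
    filter_upwards [hgv, hg.ae_nonneg] with x hx hgx
    rw [Real.norm_of_nonneg hgx, hx]
    exact (min_le_right _ _).trans (le_abs_self _)

/- With `f = v + a v ^ s` and `g = min v (b v ^ (s / 2))`, the weights `a` and `b` being chosen such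
that the two terms of `f` have the same `L¹` norm and `a ^ θ * b ^ m = 1`. -/
theorem IsTest.exists_interpolating_factors {v : Lp ℝ 2 μ} (hv : IsTest v) {θ m s : ℝ}
    (hθ : 0 ≤ θ) (hm : 0 < m) (hs : 1 ≤ s) (hθm : θ + m = 1) (hθms : θ * s + m * (s / 2) = 1) :
    ∃ f g : Lp ℝ 2 μ, IsTest f ∧ IsTest g ∧ (∀ᵐ x ∂μ, v x ≤ f x ^ θ * g x ^ m) ∧
      eLpNorm f 1 μ ≤ 2 * eLpNorm v 1 μ ∧ eLpNorm g 1 μ ≤ eLpNorm v 1 μ ∧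
      eLpNorm v 1 μ ^ θ * eLpNorm g 2 μ ^ m ≤ eLpNorm v (ENNReal.ofReal s) μ := by
  obtain rfl | hv₀ := eq_or_ne v 0
  · refine ⟨0, 0, hv, hv, ?_, le_mul_of_one_le_left' one_le_two, le_rfl, ?_⟩
    · filter_upwards [Lp.coeFn_zero ℝ 2 μ] with x h0
      rw [h0, Pi.zero_apply]
      positivity
    · rw [eLpNorm_congr_ae (p := 2) (Lp.coeFn_zero ℝ 2 μ), eLpNorm_zero,
        ENNReal.zero_rpow_of_pos hm, mul_zero]
      exact zero_le
  have hs₀ : 0 < s := one_pos.trans_le hs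
  have hvs : MemLp v (ENNReal.ofReal s) μ := hv.memLp hs
  have hV : 0 < lpNorm v (ENNReal.ofReal s) μ :=
    lpNorm_pos_of_ne_zero hv₀ (by simpa using hs₀) hvs
  obtain ⟨a, b, ha, hb, hab, haV, hbV⟩ := exists_balanced_weights (θ := θ) hm hθms
    (lpNorm_pos_of_ne_zero hv₀ one_ne_zero hv.memLp_one) hV
  obtain ⟨f, hf, hfv, f_norm⟩ := hv.exists_ae_eq_add_mul_rpow ha.le hs
  obtain ⟨g, hg, hgv, g_norm_one, g_norm_two⟩ := hv.exists_ae_eq_min_mul_rpow hb.le hs₀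
  rw [← ofReal_lpNorm hvs, ENNReal.ofReal_rpow_of_pos hV] at f_norm g_norm_two
  rw [← ENNReal.ofReal_mul ha.le, haV, ofReal_lpNorm hv.memLp_one, ← two_mul] at f_norm
  rw [← ENNReal.ofReal_mul hb.le] at g_norm_two
  refine ⟨f, g, hf, hg, ?_, f_norm, g_norm_one, ?_⟩
  · filter_upwards [hv.ae_nonneg, hfv, hgv] with x hx hfx hgx
    rw [hfx, hgx]
    exact le_rpow_mul_min_rpow hθ hθm hθms ha hb hab hx
  · refine (mul_le_mul_right (ENNReal.rpow_le_rpow g_norm_two hm.le) _).trans_eq ?_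
    rw [← ofReal_lpNorm hv.memLp_one, ENNReal.ofReal_rpow_of_nonneg lpNorm_nonneg hθ,
      ENNReal.ofReal_rpow_of_nonneg (by positivity) hm.le,
      ← ENNReal.ofReal_mul (Real.rpow_nonneg lpNorm_nonneg θ), hbV, ofReal_lpNorm hvs]

theorem IsTest.eLpNorm_op_le_of_two {T : SymmMarkovSemigroup μ} {t : ℝ≥0} {A B : ℝ≥0∞}
    (hT : ∀ g : Lp ℝ 2 μ, IsTest g →
      eLpNorm (T.op t g) 2 μ ≤ A * eLpNorm g 1 μ + B * eLpNorm g 2 μ)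
    {θ m s : ℝ} (hθ : 0 ≤ θ) (hm : 0 < m) (hs : 1 ≤ s) (hθm : θ + m = 1)
    (hθms : θ * s + m * (s / 2) = 1) {v : Lp ℝ 2 μ} (hv : IsTest v) :
    eLpNorm (T.op t v) (ENNReal.ofReal s) μ ≤
      2 * (A ^ m * eLpNorm v 1 μ + B ^ m * eLpNorm v (ENNReal.ofReal s) μ) := by
  obtain ⟨f, g, hf, hg, hle, f_norm, g_norm_one, g_norm_two⟩ :=
    hv.exists_interpolating_factors hθ hm hs hθm hθms
  have holder : eLpNorm (T.op t v) (ENNReal.ofReal s) μ ≤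
      eLpNorm (T.op t f) 1 μ ^ θ * eLpNorm (T.op t g) 2 μ ^ m := by
    simpa using hv.eLpNorm_op_le_rpow_mul_rpow T t one_pos zero_lt_two (one_pos.trans_le hs) hθ
      hm.le hθm.le (by field_simp; linarith) hf hg hle
  set N := eLpNorm v 1 μ
  calc eLpNorm (T.op t v) (ENNReal.ofReal s) μ
      ≤ (2 * N) ^ θ * (A * N + B * eLpNorm g 2 μ) ^ m := by
        refine holder.trans ?_
        gcongr
        · exact (T.eLpNorm_one_op_le t f hf.memLp_one).trans f_norm
        · exact (hT g hg).trans (by gcongr)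
    _ ≤ (2 * N) ^ θ * ((A * N) ^ m + (B * eLpNorm g 2 μ) ^ m) := by
        gcongr
        exact ENNReal.rpow_add_le_add_rpow _ _ hm.le (by linarith)
    _ = 2 ^ θ * (A ^ m * N ^ (θ + m) + B ^ m * (N ^ θ * eLpNorm g 2 μ ^ m)) := by
        simp only [ENNReal.mul_rpow_of_nonneg _ _ hθ, ENNReal.mul_rpow_of_nonneg _ _ hm.le,
          ENNReal.rpow_add_of_nonneg _ _ hθ hm.le]
        ring
    _ ≤ 2 * (A ^ m * N + B ^ m * eLpNorm v (ENNReal.ofReal s) μ) := by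
        rw [hθm, ENNReal.rpow_one]
        gcongr
        simpa using ENNReal.rpow_le_rpow_of_exponent_le one_le_two (by linarith : θ ≤ 1)

end Interpolation

section Decay

variable {α : Type*} [MeasurableSpace α] {μ : Measure α} {T : SymmMarkovSemigroup μ}

theorem eventually_mul_rpow_neg_le_rpow_neg (c : ℝ≥0) {x y : ℝ} (hxy : x < y) :
    ∀ᶠ t : ℝ≥0 in atTop, c * t ^ (-y) ≤ t ^ (-x) := by
  filter_upwards [eventually_gt_atTop 0,
    (NNReal.tendsto_rpow_atTop (sub_pos.2 hxy)).eventually_ge_atTop c] with t ht hct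
  calc c * t ^ (-y) ≤ t ^ (y - x) * t ^ (-y) := by gcongr
    _ = t ^ (-x) := by rw [← NNReal.rpow_add ht.ne']; ring_nf

theorem eventually_mul_exp_neg_mul_le_rpow_neg (c k : ℝ) {b : ℝ} (hb : 0 < b) :
    ∀ᶠ t : ℝ≥0 in atTop, c * Real.exp (-b * t) ≤ (t : ℝ) ^ (-k) := by
  have lim : Tendsto (fun t : ℝ≥0 => c * ((t : ℝ) ^ k * Real.exp (-b * t))) atTop (𝓝 (c * 0)) :=
    ((tendsto_rpow_mul_exp_neg_mul_atTop_nhds_zero k b hb).comp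
      (NNReal.tendsto_coe_atTop.2 tendsto_id)).const_mul c
  rw [mul_zero] at lim
  filter_upwards [lim.eventually_le_const one_pos, eventually_gt_atTop 0] with t hle ht
  have : 0 < (t : ℝ) ^ k := Real.rpow_pos_of_pos ht k
  calc c * Real.exp (-b * t)
      = c * ((t : ℝ) ^ k * Real.exp (-b * t)) * (t : ℝ) ^ (-k) := by
        rw [Real.rpow_neg t.coe_nonneg]; field_simp
    _ ≤ (t : ℝ) ^ (-k) := mul_le_of_le_one_left (by positivity) hle

namespace SymmMarkovSemigroup

/-- The semigroup maps `L^q` to `L^p` at the rate `t^{-ρ}` for large times, up to an error term in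
the `L^p` norm which decreases faster than every power of `t`. -/
def HasDecay (T : SymmMarkovSemigroup μ) (ρ q p : ℝ) : Prop :=
  ∃ C : ℝ≥0, ∀ k : ℝ, ∀ᶠ t : ℝ≥0 in atTop, ∀ f : Lp ℝ 2 μ, IsTest f →
    eLpNorm (T.op t f) (ENNReal.ofReal p) μ ≤
      (C * t ^ (-ρ) : ℝ≥0) * eLpNorm f (ENNReal.ofReal q) μ +
        (t ^ (-k) : ℝ≥0) * eLpNorm f (ENNReal.ofReal p) μ

theorem NashInequality.eLpNorm_op_two_le {C d : ℝ} (h : T.NashInequality C 1 d) (hC : 0 < C)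
    (hd : 0 < d) {f : Lp ℝ 2 μ} (hf : MemLp f 1 μ) {t : ℝ≥0} (ht : 0 < t) :
    eLpNorm (T.op t f) 2 μ ≤ (((3 * d / (2 * C)).toNNReal / t) ^ (d / 2) : ℝ≥0) * eLpNorm f 1 μ +
      ENNReal.ofReal (Real.exp (-(C / 3) * t)) * eLpNorm f 2 μ := by
  have norm_le := h.norm_op_le hC hd hf ht
  have rate : (3 * d / (2 * C * t)) ^ (d / 2) =
      (((3 * d / (2 * C)).toNNReal / t) ^ (d / 2) : ℝ≥0) := by
    rw [NNReal.coe_rpow, NNReal.coe_div, Real.coe_toNNReal _ (by positivity), div_div]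
  rw [rate, norm_eq_lpNorm, norm_eq_lpNorm] at norm_le
  rw [← ofReal_lpNorm (Lp.memLp _), ← ofReal_lpNorm hf, ← ofReal_lpNorm (Lp.memLp f),
    ← ENNReal.ofReal_coe_nnreal, ← ENNReal.ofReal_mul NNReal.zero_le_coe,
    ← ENNReal.ofReal_mul (Real.exp_pos _).le,
    ← ENNReal.ofReal_add (mul_nonneg NNReal.zero_le_coe lpNorm_nonneg)
      (mul_nonneg (Real.exp_pos _).le lpNorm_nonneg)]
  exact ENNReal.ofReal_le_ofReal norm_le

theorem NashInequality.hasDecay_of_le_two {C d : ℝ} (h : T.NashInequality C 1 d) (hC : 0 < C)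
    (hd : 0 < d) {s : ℝ} (hs₁ : 1 < s) (hs₂ : s ≤ 2) : T.HasDecay (d * (1 - 1 / s)) 1 s := by
  have hs₀ : 0 < s := one_pos.trans hs₁
  set κ := (3 * d / (2 * C)).toNNReal
  set θ := (2 - s) / s with hθ
  set m := 2 * (s - 1) / s with hm
  have hm₀ : 0 < m := div_pos (by linarith) hs₀
  have hrate : d / 2 * m = d * (1 - 1 / s) := by rw [hm]; field_simp
  refine ⟨2 * κ ^ (d * (1 - 1 / s)), fun k => ?_⟩
  filter_upwards [eventually_gt_atTop 0, eventually_mul_exp_neg_mul_le_rpow_neg 2 k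
    (mul_pos (by linarith : 0 < C / 3) hm₀)] with t ht hexp f hf
  refine (hf.eLpNorm_op_le_of_two (fun g hg => h.eLpNorm_op_two_le hC hd hg.memLp_one ht)
    (θ := θ) (div_nonneg (by linarith) hs₀.le) hm₀ hs₁.le (by rw [hθ, hm]; field_simp; ring)
    (by rw [hθ, hm]; field_simp; ring)).trans ?_
  rw [mul_add, ← mul_assoc, ← mul_assoc, ENNReal.ofReal_one]
  gcongr
  · rw [← ENNReal.coe_rpow_of_nonneg _ hm₀.le, ← NNReal.rpow_mul, hrate, NNReal.div_rpow,
      NNReal.rpow_neg, mul_assoc, ← div_eq_mul_inv]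
    norm_cast
  · rw [ENNReal.ofReal_rpow_of_pos (Real.exp_pos _), ← Real.exp_mul,
      ← ENNReal.ofReal_ofNat, ← ENNReal.ofReal_mul zero_le_two, ← ENNReal.ofReal_coe_nnreal,
      NNReal.coe_rpow]
    refine ENNReal.ofReal_le_ofReal (le_trans (le_of_eq ?_) hexp)
    ring_nf

theorem HasDecay.rpow {ρ q p m : ℝ} (h : T.HasDecay ρ q p) (hq : 0 ≤ q) (hp : 0 < p)
    (hm : 1 ≤ m) : T.HasDecay (ρ / m) (q * m) (p * m) := by
  have hm₀ : 0 < m := one_pos.trans_le hm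
  obtain ⟨C, hC⟩ := h
  refine ⟨C ^ m⁻¹, fun k => ?_⟩
  filter_upwards [hC (k * m)] with t ht f hf
  obtain ⟨g, hg, hgf⟩ := hf.exists_ae_eq_rpow hm
  have norm_g {e : ℝ} (he : 0 ≤ e) :
      eLpNorm g (ENNReal.ofReal e) μ = eLpNorm f (ENNReal.ofReal (e * m)) μ ^ m := by
    rw [eLpNorm_congr_ae hgf, eLpNorm_rpow_of_ae_nonneg hf.ae_nonneg he hm₀]
  have bound := (hf.eLpNorm_op_rpow_le T t hp hm hg hgf).trans (ht g hg)
  rw [norm_g hq, norm_g hp.le] at bound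
  have root (c : ℝ≥0) (N : ℝ≥0∞) : (c * N ^ m) ^ m⁻¹ = (c ^ m⁻¹ : ℝ≥0) * N := by
    rw [ENNReal.mul_rpow_of_nonneg _ _ (by positivity), ENNReal.rpow_rpow_inv hm₀.ne',
      ENNReal.coe_rpow_of_nonneg _ (by positivity)]
  calc eLpNorm (T.op t f) (ENNReal.ofReal (p * m)) μ
      ≤ ((C * t ^ (-ρ) : ℝ≥0) * eLpNorm f (ENNReal.ofReal (q * m)) μ ^ m +
          (t ^ (-(k * m)) : ℝ≥0) * eLpNorm f (ENNReal.ofReal (p * m)) μ ^ m) ^ m⁻¹ :=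
        (ENNReal.le_rpow_inv_iff hm₀).2 bound
    _ ≤ ((C * t ^ (-ρ)) ^ m⁻¹ : ℝ≥0) * eLpNorm f (ENNReal.ofReal (q * m)) μ +
          ((t ^ (-(k * m))) ^ m⁻¹ : ℝ≥0) * eLpNorm f (ENNReal.ofReal (p * m)) μ := by
        rw [← root, ← root]
        exact ENNReal.rpow_add_le_add_rpow _ _ (by positivity) (inv_le_one_of_one_le₀ hm)
    _ = _ := by
        rw [NNReal.mul_rpow, ← NNReal.rpow_mul, ← NNReal.rpow_mul, neg_mul, neg_mul,
          mul_inv_cancel_right₀ hm₀.ne', ← div_eq_mul_inv]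

theorem HasDecay.exists_eventually_le_of_le {ρ q b p : ℝ} (h : T.HasDecay ρ q b) (hq : 0 < q)
    (hqb : q ≤ b) (hbp : b ≤ p) :
    ∃ C : ℝ≥0, ∀ k : ℝ, ∀ᶠ t : ℝ≥0 in atTop, ∀ f : Lp ℝ 2 μ, IsTest f →
      eLpNorm (T.op t f) (ENNReal.ofReal b) μ ≤
        (C * t ^ (-ρ) : ℝ≥0) * eLpNorm f (ENNReal.ofReal q) μ +
          (t ^ (-k) : ℝ≥0) * eLpNorm f (ENNReal.ofReal p) μ := by
  obtain ⟨C, hC⟩ := h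
  refine ⟨C + 1, fun k => ?_⟩
  filter_upwards [hC (max ρ k), eventually_ge_atTop 1] with t ht ht₁ f hf
  set Nq := eLpNorm f (ENNReal.ofReal q) μ
  set Np := eLpNorm f (ENNReal.ofReal p) μ
  have hNb : eLpNorm f (ENNReal.ofReal b) μ ≤ Nq + Np :=
    (eLpNorm_le_max hq hqb hbp (Lp.aestronglyMeasurable f)).trans (max_le le_self_add le_add_self)
  calc eLpNorm (T.op t f) (ENNReal.ofReal b) μ
      ≤ (C * t ^ (-ρ) : ℝ≥0) * Nq + (t ^ (-max ρ k) : ℝ≥0) * (Nq + Np) :=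
        (ht f hf).trans (by gcongr)
    _ ≤ (C * t ^ (-ρ) : ℝ≥0) * Nq + ((t ^ (-ρ) : ℝ≥0) * Nq + (t ^ (-k) : ℝ≥0) * Np) := by
        rw [mul_add]
        gcongr <;> simp only [le_max_left, le_max_right]
    _ = ((C + 1) * t ^ (-ρ) : ℝ≥0) * Nq + (t ^ (-k) : ℝ≥0) * Np := by push_cast; ring

theorem HasDecay.trans {x y q b p : ℝ} (hx : T.HasDecay x q b) (hy : T.HasDecay y b p)
    (hq : 0 < q) (hqb : q ≤ b) (hbp : b ≤ p) (hp : 1 ≤ p) : T.HasDecay (x + y) q p := by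
  obtain ⟨C₁, h₁⟩ := hx.exists_eventually_le_of_le hq hqb hbp
  obtain ⟨C₂, h₂⟩ := hy
  refine ⟨C₂ * C₁ * 2 ^ (x + y), fun k => ?_⟩
  have half : Tendsto (fun t : ℝ≥0 => t / 2) atTop atTop := tendsto_id.atTop_div_const two_pos
  filter_upwards [half.eventually (h₁ (k + 1 - y)), half.eventually (h₂ (k + 1)),
    half.eventually (eventually_gt_atTop 0),
    eventually_mul_rpow_neg_le_rpow_neg ((C₂ + 1) * 2 ^ (k + 1)) (lt_add_one k)]
    with t ht₁ ht₂ ht hk f hf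
  set u := t / 2
  have half_rpow (a : ℝ) : u ^ (-a) = 2 ^ a * t ^ (-a) := by
    rw [NNReal.div_rpow, NNReal.rpow_neg 2, div_inv_eq_mul, mul_comm]
  set Nq := eLpNorm f (ENNReal.ofReal q) μ
  set Np := eLpNorm f (ENNReal.ofReal p) μ
  calc eLpNorm (T.op t f) (ENNReal.ofReal p) μ
      = eLpNorm (T.op u (T.op u f)) (ENNReal.ofReal p) μ := by rw [← op_add_apply, add_halves]
    _ ≤ (C₂ * u ^ (-y) : ℝ≥0) *
          ((C₁ * u ^ (-x) : ℝ≥0) * Nq + (u ^ (-(k + 1 - y)) : ℝ≥0) * Np) +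
        (u ^ (-(k + 1)) : ℝ≥0) * Np := by
        refine (ht₂ _ (hf.op T u)).trans ?_
        gcongr
        exacts [ht₁ f hf, hf.eLpNorm_op_le T u hp]
    _ = (C₂ * C₁ * u ^ (-(x + y)) : ℝ≥0) * Nq + ((C₂ + 1) * u ^ (-(k + 1)) : ℝ≥0) * Np := by
        rw [show -(x + y) = -y + -x by ring, show -(k + 1) = -y + -(k + 1 - y) by ring,
          NNReal.rpow_add ht.ne', NNReal.rpow_add ht.ne']
        push_cast
        ring
    _ ≤ (C₂ * C₁ * 2 ^ (x + y) * t ^ (-(x + y)) : ℝ≥0) * Nq + (t ^ (-k) : ℝ≥0) * Np := by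
        rw [half_rpow, half_rpow, ← mul_assoc, ← mul_assoc]
        gcongr

theorem NashInequality.hasDecay_one {C d : ℝ} (h : T.NashInequality C 1 d) (hC : 0 < C)
    (hd : 0 < d) {s : ℝ} (hs : 1 < s) : T.HasDecay (d * (1 - 1 / s)) 1 s := by
  obtain ⟨n, hn⟩ := pow_unbounded_of_one_lt s one_lt_two
  induction n generalizing s with
  | zero => linarith
  | succ n ih =>
    rcases le_or_gt s 2 with hs₂ | hs₂
    · exact h.hasDecay_of_le_two hC hd hs hs₂
    have first := ih (s := s / 2) (by linarith) (by rw [pow_succ] at hn; linarith)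
    have second := (h.hasDecay_of_le_two hC hd one_lt_two le_rfl).rpow zero_le_one two_pos
      (m := s / 2) (by linarith)
    rw [one_mul, mul_div_cancel₀ _ two_ne_zero] at second
    convert first.trans second one_pos (by linarith) (by linarith) hs.le using 1
    field_simp
    ring

theorem NashInequality.hasDecay {C d : ℝ} (h : T.NashInequality C 1 d) (hC : 0 < C)
    (hd : 0 < d) {q p : ℝ} (hq : 1 ≤ q) (hqp : q < p) : T.HasDecay (d * (1 / q - 1 / p)) q p := by
  have hq₀ : 0 < q := one_pos.trans_le hq
  have ratio : 1 < p / q := (one_lt_div hq₀).2 hqp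
  have decay := (h.hasDecay_one hC hd ratio).rpow zero_le_one (one_pos.trans ratio) hq
  rw [one_mul, div_mul_cancel₀ _ hq₀.ne'] at decay
  convert decay using 1
  have hp₀ := hq₀.trans hqp
  field_simp

end SymmMarkovSemigroup

end Decay

section ExtensionToLOne

variable {α : Type*} [MeasurableSpace α] {μ : Measure α} {T : SymmMarkovSemigroup μ}

theorem exists_seq_memLp_tendsto {E : Type*} [NormedAddCommGroup E] {p : ℝ≥0∞}
    [Fact (1 ≤ p)] (hp : p ≠ ∞) (v : Lp E p μ) :
    ∃ V : ℕ → Lp E p μ, Tendsto V atTop (𝓝 v) ∧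
      ∀ n q, (q ≠ 0 → MemLp (V n) q μ) ∧ eLpNorm (V n) q μ ≤ 2 * eLpNorm v q μ := by
  borelize E
  have hv : StronglyMeasurable v := Lp.stronglyMeasurable v
  have := hv.separableSpace_range_union_singleton (b := 0)
  have memLp := SimpleFunc.memLp_approxOn_range hv.measurable (Lp.memLp v)
  refine ⟨fun n => (memLp n).toLp _, by simpa only [Lp.toLp_coeFn] using
    SimpleFunc.tendsto_approxOn_range_Lp hp hv.measurable (Lp.memLp v),
    fun n q => ⟨fun hq => ?_, ?_⟩⟩
  · rw [memLp_congr_ae (memLp n).coeFn_toLp]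
    rcases eq_or_ne q ∞ with rfl | hq_top
    · exact SimpleFunc.memLp_top _ μ
    · exact (SimpleFunc.memLp_iff hq hq_top).2
        ((SimpleFunc.memLp_iff (one_pos.trans_le Fact.out).ne' hp).1 (memLp n))
  · rw [eLpNorm_congr_ae (memLp n).coeFn_toLp]
    suffices h : ∀ x, ‖SimpleFunc.approxOn v hv.measurable (Set.range v ∪ {0}) 0 (by simp) n x‖ ≤
        (2 : ℝ≥0) * ‖v x‖ from
      (eLpNorm_le_nnreal_smul_eLpNorm_of_ae_le_mul (.of_forall h) q).trans_eq
        (by rw [ENNReal.smul_def, smul_eq_mul, ENNReal.coe_ofNat])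
    intro x
    rw [NNReal.coe_ofNat, two_mul]
    exact SimpleFunc.norm_approxOn_zero_le hv.measurable (by simp) x n

namespace SymmMarkovSemigroup

theorem exists_isTest_abs_opL1_le (T : SymmMarkovSemigroup μ) (t : ℝ≥0) {v : Lp ℝ 1 μ}
    (hv₂ : MemLp v 2 μ) (hv : MemLp v ∞ μ) :
    ∃ f : Lp ℝ 2 μ, IsTest f ∧ f =ᵐ[μ] (fun x => |v x|) ∧ ∀ᵐ x ∂μ, |T.opL1 t v x| ≤ T.op t f x := by
  have eq : (|hv₂.toLp v| : Lp ℝ 2 μ) =ᵐ[μ] fun x => |v x| := by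
    filter_upwards [Lp.coeFn_abs (hv₂.toLp v), hv₂.coeFn_toLp] with x habs hx
    rw [habs, hx]
  refine ⟨|hv₂.toLp v|, ⟨abs_nonneg _, (memLp_congr_ae eq).2 (Lp.memLp v).abs,
    (memLp_congr_ae eq).2 hv.abs⟩, eq, ?_⟩
  filter_upwards [T.opL1_ae_eq t v hv₂, (Lp.coeFn_le _ _).2 (T.abs_op_le t (hv₂.toLp v)),
    Lp.coeFn_abs (T.op t (hv₂.toLp v))] with x hx hle habs
  rwa [hx, ← habs]

theorem HasDecay.exists_eventually_opL1_le {ρ q p : ℝ} (h : T.HasDecay ρ q p) :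
    ∃ C : ℝ≥0, ∀ k : ℝ, ∀ᶠ t : ℝ≥0 in atTop, ∀ v : Lp ℝ 1 μ,
      eLpNorm (T.opL1 t v) (ENNReal.ofReal p) μ ≤
        (C * t ^ (-ρ) : ℝ≥0) * (2 * eLpNorm v (ENNReal.ofReal q) μ) +
          (t ^ (-k) : ℝ≥0) * (2 * eLpNorm v (ENNReal.ofReal p) μ) := by
  obtain ⟨C, hC⟩ := h
  refine ⟨C, fun k => ?_⟩
  filter_upwards [hC k] with t ht v
  obtain ⟨V, hV, hVn⟩ := exists_seq_memLp_tendsto ENNReal.one_ne_top v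
  refine eLpNorm_le_of_tendstoInMeasure (Eventually.of_forall fun n => ?_)
    (tendstoInMeasure_of_tendsto_Lp (((T.opL1 t).continuous.tendsto v).comp hV))
    fun n => Lp.aestronglyMeasurable _
  obtain ⟨f, hf, hfV, hle⟩ := T.exists_isTest_abs_opL1_le t ((hVn n 2).1 two_ne_zero)
    ((hVn n ∞).1 ENNReal.top_ne_zero)
  have norm_f (e : ℝ≥0∞) : eLpNorm f e μ ≤ 2 * eLpNorm v e μ := by
    rw [eLpNorm_congr_ae hfV]
    exact (eLpNorm_norm (V n)).trans_le (hVn n e).2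
  calc eLpNorm (T.opL1 t (V n)) (ENNReal.ofReal p) μ
      ≤ eLpNorm (T.op t f) (ENNReal.ofReal p) μ := eLpNorm_mono_ae_real hle
    _ ≤ _ := ht f hf
    _ ≤ _ := by gcongr <;> exact norm_f _

theorem HasDecay.exists_forall_exists_opL1_le {ρ q p : ℝ} (h : T.HasDecay ρ q p) (hq : 0 < q) :
    ∃ C : ℝ, 0 < C ∧ ∀ v : Lp ℝ 1 μ, MemLp v (ENNReal.ofReal p) μ →
      ∃ t₀ : ℝ, 0 < t₀ ∧ ∀ t : ℝ≥0, t₀ < t →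
        eLpNorm (T.opL1 t v) (ENNReal.ofReal p) μ ≤
          ENNReal.ofReal (C * (t : ℝ) ^ (-ρ)) * eLpNorm v (ENNReal.ofReal q) μ := by
  obtain ⟨C, hC⟩ := h.exists_eventually_opL1_le
  refine ⟨2 * C + 1, by positivity, fun v hv => ?_⟩
  set Nq := eLpNorm v (ENNReal.ofReal q) μ
  set Np := eLpNorm v (ENNReal.ofReal p) μ
  obtain ⟨c, hc⟩ : ∃ c : ℝ≥0, 2 * Np ≤ c * Nq := by
    rcases eq_or_ne Nq 0 with hNq₀ | hNq₀
    · refine ⟨0, ?_⟩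
      rw [eLpNorm_eq_zero_iff (Lp.aestronglyMeasurable v) (by simpa using hq)] at hNq₀
      simp [Np, eLpNorm_congr_ae hNq₀]
    · obtain ⟨n, hn⟩ := ENNReal.exists_nat_mul_gt hNq₀
        (ENNReal.mul_ne_top ENNReal.ofNat_ne_top hv.2.ne : 2 * Np ≠ ∞)
      exact ⟨n, hn.le⟩
  obtain ⟨t₀, ht₀⟩ := eventually_atTop.1
    ((hC (ρ + 1)).and (eventually_mul_rpow_neg_le_rpow_neg c (lt_add_one ρ)))
  refine ⟨t₀ + 1, by positivity, fun t ht => ?_⟩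
  obtain ⟨decay, absorb⟩ := ht₀ t (by exact_mod_cast ((lt_add_one (t₀ : ℝ)).trans ht).le)
  have rate : ENNReal.ofReal ((2 * C + 1) * (t : ℝ) ^ (-ρ)) = ((2 * C + 1) * t ^ (-ρ) : ℝ≥0) := by
    rw [← ENNReal.ofReal_coe_nnreal]
    push_cast
    rfl
  calc eLpNorm (T.opL1 t v) (ENNReal.ofReal p) μ
      ≤ (C * t ^ (-ρ) : ℝ≥0) * (2 * Nq) + (t ^ (-(ρ + 1)) : ℝ≥0) * (2 * Np) := decay v
    _ ≤ (C * t ^ (-ρ) : ℝ≥0) * (2 * Nq) + (t ^ (-(ρ + 1)) : ℝ≥0) * (c * Nq) := by gcongr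
    _ = (2 * C * t ^ (-ρ) + c * t ^ (-(ρ + 1)) : ℝ≥0) * Nq := by push_cast; ring
    _ ≤ (2 * C * t ^ (-ρ) + t ^ (-ρ) : ℝ≥0) * Nq := by gcongr
    _ = ENNReal.ofReal ((2 * C + 1) * (t : ℝ) ^ (-ρ)) * Nq := by rw [rate, add_mul, one_mul]

end SymmMarkovSemigroup

end ExtensionToLOne

theorem mainTheorem2_general {α : Type*} [MeasurableSpace α] {μ : Measure α}
    (T : SymmMarkovSemigroup μ) (r d C₁ : ℝ) (hr₁ : 1 ≤ r) (hr₂ : r < 2) (hd : 0 < d)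
    (hC₁ : 0 < C₁)
    (hNash : ∀ f : Lp ℝ 2 μ, f ∈ T.formDomain → MemLp f 1 μ →
      eLpNorm f (ENNReal.ofReal r) μ = 1 → C₁ * ‖f‖ ^ 2 * min 1 (‖f‖ ^ (2 / d)) ≤ T.form f f)
    (q p : ℝ) (hq : 1 ≤ q) (hqp : q < p) :
    ∃ C₂ : ℝ, 0 < C₂ ∧ ∀ v : Lp ℝ 1 μ, MemLp v (ENNReal.ofReal p) μ →
      ∃ t₀ : ℝ, 0 < t₀ ∧ ∀ t : ℝ≥0, t₀ < t →
        eLpNorm (T.opL1 t v) (ENNReal.ofReal p) μ ≤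
          ENNReal.ofReal (C₂ * (t : ℝ) ^ (-(d * r / (2 - r) * (1 / q - 1 / p)))) *
            eLpNorm v (ENNReal.ofReal q) μ := by
  have nash_r : T.NashInequality C₁ r d :=
    SymmMarkovSemigroup.nashInequality_of_norm_eq_one hr₁ hr₂.le hNash
  have nash_one : T.NashInequality C₁ 1 (d * r / (2 - r)) :=
    nash_r.exponent_one hC₁.le hr₁ hr₂ hd
  have decay : T.HasDecay (d * r / (2 - r) * (1 / q - 1 / p)) q p :=
    nash_one.hasDecay hC₁ (div_pos (by positivity) (sub_pos.2 hr₂)) hq hqp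
  exact decay.exists_forall_exists_opL1_le (one_pos.trans_le hq)

theorem mainTheorem2 {N : ℕ}
    (T : SymmMarkovSemigroup (volume : Measure (EuclideanSpace ℝ (Fin N))))
    (r d C₁ : ℝ) (hr₁ : 1 ≤ r) (hr₂ : r < 2) (hd : 0 < d) (hC₁ : 0 < C₁)
    (hNash : ∀ f : Lp ℝ 2 (volume : Measure (EuclideanSpace ℝ (Fin N))),
      f ∈ T.formDomain → MemLp f 1 volume → eLpNorm f (ENNReal.ofReal r) volume = 1 →
      C₁ * ‖f‖ ^ 2 * min 1 (‖f‖ ^ (2 / d)) ≤ T.form f f)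
    (q p : ℝ) (hq : 1 ≤ q) (hqp : q < p) :
    ∃ C₂ : ℝ, 0 < C₂ ∧
      ∀ v : Lp ℝ 1 (volume : Measure (EuclideanSpace ℝ (Fin N))),
        MemLp v (ENNReal.ofReal p) volume →
        ∃ t₀ : ℝ, 0 < t₀ ∧ ∀ t : ℝ≥0, t₀ < t →
          eLpNorm (T.opL1 t v) (ENNReal.ofReal p) volume ≤
            ENNReal.ofReal (C₂ * (t : ℝ) ^ (-(d * r / (2 - r) * (1 / q - 1 / p)))) *
              eLpNorm v (ENNReal.ofReal q) volume :=
  mainTheorem2_general T r d C₁ hr₁ hr₂ hd hC₁ hNash q p hq hqp
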